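/- Let $n\ge 1$, $p\ge 0$ be integers, let $\boldsymbol X\in\mathbb R^{n\times p}$ be a random matrix with i.i.d. $\mathcal N(0,1)$ entries and rows $\boldsymbol X_1^\top,\dots,\boldsymbol X_n^\top$, let $\tilde y_1,\dots,\tilde y_n\in\{-1,1\}$ be labels (which may be random and may depend on $\boldsymbol X$ arbitrarily), let $\rho:\mathbb R\to\mathbb R$ be twice differentiable with $\rho''\ge 0$, and let $$\ell(\boldsymbol\beta)=\sum_{i=1}^n\rho\big(-\tilde y_i\boldsymbol X_i^\top\boldsymbol\beta\big),\qquad \boldsymbol\beta\in\mathbb R^p .$$ Put $H(\epsilon)=-\epsilon\log\epsilon-(1-\epsilon)\log(1-\epsilon)$ (natural logarithm, $0\log 0=0$) and $$g_{n,p}(\epsilon)=\sqrt{1-\epsilon}-\sqrt{p/n}-2\sqrt{\tfrac{H(\epsilon)}{1-\epsilon}} .$$ Consider the following assertion $(\ast)$: with probability at least $1-2\exp(-nH(\epsilon))-2\exp(-n/2)$, the matrix inequality $$\frac1n\nabla^2\ell(\boldsymbol\beta)\;\succeq\;\Big(\inf_{z:\,|z|\le 3\|\boldsymbol\beta\|/\sqrt\epsilon}\rho''(z)\Big)\,g_{n,p}(\epsilon)^2\,\boldsymbol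 I$$ holds simultaneously for all $\boldsymbol\beta\in\mathbb R^p$. (For $\epsilon=0$ the probability bound is negative and $(\ast)$ says nothing.) (i) There is a universal constant $\epsilon_0>0$ such that, whenever $p/n<1$, $0\le\epsilon\le\epsilon_0$ and $g_{n,p}(\epsilon)\ge 0$, the assertion $(\ast)$ holds. (ii) For every $\kappa<1$ there is a constant $\epsilon_0>0$, depending only on $\kappa$, such that $(\ast)$ holds whenever $p/n\le\kappa$ and $0\le\epsilon\le\epsilon_0$. -/

import Mathlib

open MeasureTheory ProbabilityTheory

/-- The negative log-likelihood `ℓ(β) = ∑ᵢ ρ(-ỹᵢ Xᵢᵀβ)` with effective link `ρ`, design matrix `X`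
(whose rows are the `Xᵢ`) and labels `ỹᵢ`. -/
noncomputable def negLogLik (ρ : ℝ → ℝ) {n p : ℕ} (X : Matrix (Fin n) (Fin p) ℝ) (y : Fin n → ℝ)
    (β : EuclideanSpace ℝ (Fin p)) : ℝ :=
  ∑ i, ρ (-(y i) * ∑ j, X i j * β j)

/-- The Hessian matrix `∇²f(β)`, whose `(j, k)` entry is the second partial derivative. -/
noncomputable def hessianMatrix {p : ℕ} (f : EuclideanSpace ℝ (Fin p) → ℝ)
    (β : EuclideanSpace ℝ (Fin p)) : Matrix (Fin p) (Fin p) ℝ :=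
  Matrix.of fun j k =>
    fderiv ℝ (fderiv ℝ f) β (EuclideanSpace.single j 1) (EuclideanSpace.single k 1)

/-- The quantity `√(1-ε) - √(p/n) - 2√(H(ε)/(1-ε))`, with `H` the binary entropy (natural
logarithm). -/
noncomputable def curvatureGap (n p : ℕ) (ε : ℝ) : ℝ :=
  √(1 - ε) - √((p : ℝ) / n) - 2 * √(Real.binEntropy ε / (1 - ε))

/-- With probability at least `1 - 2 exp(-n H(ε)) - 2 exp(-n/2)`, simultaneously for all `β`,
`∇²ℓ(β)/n ⪰ (inf_{|z| ≤ 3‖β‖/√ε} ρ''(z)) (√(1-ε) - √(p/n) - 2√(H(ε)/(1-ε)))² I`. -/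
def LikelihoodCurvature {Ω : Type*} [MeasurableSpace Ω] (P : Measure Ω) (ρ : ℝ → ℝ) {n p : ℕ}
    (X : Ω → Matrix (Fin n) (Fin p) ℝ) (y : Ω → Fin n → ℝ) (ε : ℝ) : Prop :=
  ∃ E : Set Ω, MeasurableSet E ∧
    1 - 2 * Real.exp (-(n * Real.binEntropy ε)) - 2 * Real.exp (-((n : ℝ) / 2)) ≤ P.real E ∧
    ∀ ω ∈ E, ∀ β : EuclideanSpace ℝ (Fin p),
      ((1 / (n : ℝ)) • hessianMatrix (negLogLik ρ (X ω) (y ω)) β -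
        (sInf (deriv (deriv ρ) '' {z : ℝ | |z| ≤ 3 * ‖β‖ / √ε}) * curvatureGap n p ε ^ 2) •
          (1 : Matrix (Fin p) (Fin p) ℝ)).PosSemidef

/-- The entries of the `n × p` design matrix `X` are i.i.d. `N(0,1)`. -/
structure IsStdGaussianDesign {Ω : Type*} [MeasurableSpace Ω] (P : Measure Ω) {n p : ℕ}
    (X : Ω → Matrix (Fin n) (Fin p) ℝ) : Prop where
  law : ∀ i j, HasLaw (fun ω => X ω i j) (gaussianReal 0 1) P
  indep : iIndepFun (fun (ij : Fin n × Fin p) ω => X ω ij.1 ij.2) P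

namespace GaussianDesign

open Real Filter Topology

/-! The Hessian is `∑ᵢ ρ''(±Xᵢᵀβ) XᵢXᵢᵀ`: the labels enter only through signs that do not change
`|Xᵢᵀβ|`, so their dependence on `X` is harmless. If `‖X‖ ≤ 3√n`, then for every `β` at most `⌊εn⌋`
rows satisfy `|Xᵢᵀβ| > 3‖β‖/√ε`. Discarding rows only lowers the Hessian, since `ρ'' ≥ 0`, so it
suffices to bound below the smallest singular value of every submatrix with exactly `n - ⌊εn⌋` rows
(`posSemidef_hessian`). There are at most `exp(nH(ε))` of them (`choose_le_exp_binEntropy`). With `t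
= 2√(nH/(1-ε))`, a tail `2 exp(-t²/2) ≤ 2 exp(-2nH)` for each submatrix survives the union bound.

Both singular value tails come from Gordon's comparison applied directly to Laplace transforms, so
no separate concentration inequality is needed. The functional `softF a b = (∑ᵤ (∑ᵥ exp xᵤᵥ)ᵃ)ᵇ`,
evaluated at `βx` with `b = t/β` and `β → ∞`, becomes `exp(-t minᵤ maxᵥ xᵤᵥ)` for `a = -1` and
`exp(t maxᵤ maxᵥ xᵤᵥ)` for `a = 1`. Gaussian interpolation (`integral_softF_le`) compares `vᵀGu +
γ`, with `γ` an independent scalar Gaussian, to `⟨g,v⟩ + ⟨h,u⟩`. For the minimum this gives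
`exp(t²/2) E exp(-t min‖Gu‖) ≤ E exp(-t‖g‖) · E exp(t‖h‖)`, and the factor from `γ` cancels the
`exp(t²/2)` in the bound on `E exp(t‖h‖)`. The norm moments are estimated in
`integral_exp_mul_norm_le` and `integral_exp_neg_mul_norm_le`. Markov's inequality finishes.

The lower tail requires `exp(t²/2) ≥ 2` and `t ≤ √m/4` for `m` rows. The first holds whenever the
claimed probability is positive, because then `nH > log 2`; the second holds because `ε` is small.
-/

/-- The standard Gaussian measure on `ι → ℝ`. -/
noncomputable abbrev stdPi (ι : Type*) [Fintype ι] : Measure (ι → ℝ) :=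
  Measure.pi fun _ => gaussianReal 0 1

/-- `f` grows at most exponentially. -/
def ExpGrowth {ι : Type*} [Fintype ι] (f : (ι → ℝ) → ℝ) : Prop :=
  ∃ C c : ℝ, ∀ w, |f w| ≤ C * exp (c * ∑ k, |w k|)

/-! ### One-dimensional Gaussian integration by parts. -/

section OneDim

lemma integrable_exp_mul_abs_gaussian (c : ℝ) :
    Integrable (fun x : ℝ => exp (c * |x|)) (gaussianReal 0 1) := by
  have := integrable_exp_mul_abs (X := fun x : ℝ => x) (t := c) (μ := gaussianReal 0 1)
    (integrable_exp_mul_gaussianReal c) (integrable_exp_mul_gaussianReal (-c))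
  exact this

lemma integrable_of_abs_le_exp {h : ℝ → ℝ} (hm : Measurable h) {C c : ℝ}
    (hh : ∀ x, |h x| ≤ C * exp (c * |x|)) : Integrable h (gaussianReal 0 1) :=
  ((integrable_exp_mul_abs_gaussian c).const_mul C).mono' hm.aestronglyMeasurable
    (ae_of_all _ hh)

lemma integrable_gaussianReal_iff {h : ℝ → ℝ} :
    Integrable h (gaussianReal 0 1) ↔
      Integrable (fun x => gaussianPDFReal 0 1 x * h x) := by
  rw [gaussianReal_of_var_ne_zero _ one_ne_zero,
    integrable_withDensity_iff_integrable_smul' (measurable_gaussianPDF 0 1)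
      (ae_of_all _ fun _ => gaussianPDF_lt_top)]
  simp only [toReal_gaussianPDF, smul_eq_mul]

lemma hasDerivAt_gaussianPDFReal (x : ℝ) :
    HasDerivAt (gaussianPDFReal 0 1) (-(gaussianPDFReal 0 1 x * x)) x := by
  have h : gaussianPDFReal 0 1 = fun x => (√(2 * π * (1 : NNReal)))⁻¹ *
      exp (-(x - 0) ^ 2 / (2 * (1 : NNReal))) := by
    ext; rw [gaussianPDFReal]
  rw [h]
  have h2 : HasDerivAt (fun x : ℝ => -(x - 0) ^ 2 / (2 * ((1 : NNReal) : ℝ))) (-x) x := by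
    have := ((((hasDerivAt_id x).sub_const 0).pow 2).neg).div_const (2 * ((1 : NNReal) : ℝ))
    refine this.congr_deriv ?_
    simp only [id, NNReal.coe_one]
    norm_num
    ring
  refine (h2.exp.const_mul _).congr_deriv ?_
  ring

/-- The density satisfies `φ' = -xφ`, so this is integration by parts on the line; the growth bounds
make all three products with `φ` integrable. -/
lemma gaussian_ibp_one {h h' : ℝ → ℝ} (hd : ∀ x, HasDerivAt h (h' x) x) {C c : ℝ}
    (hh : ∀ x, |h x| ≤ C * exp (c * |x|)) (hh' : ∀ x, |h' x| ≤ C * exp (c * |x|)) :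
    ∫ x, x * h x ∂(gaussianReal 0 1) = ∫ x, h' x ∂(gaussianReal 0 1) := by
  have hm : Measurable h := (continuous_iff_continuousAt.2 fun x => (hd x).continuousAt).measurable
  have hm' : Measurable h' := by
    have : h' = deriv h := by ext x; exact (hd x).deriv.symm
    rw [this]; exact measurable_deriv h
  have hxh : ∀ x, |x * h x| ≤ C * exp ((c + 1) * |x|) := by
    intro x
    have h1 : |x| ≤ exp |x| := by linarith [add_one_le_exp |x|]
    calc |x * h x| = |x| * |h x| := abs_mul _ _
      _ ≤ exp |x| * (C * exp (c * |x|)) := by gcongr; exact hh x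
      _ = C * exp ((c + 1) * |x|) := by rw [add_mul, exp_add]; ring_nf
  have i0 := integrable_gaussianReal_iff.1 (integrable_of_abs_le_exp hm hh)
  have i1 := integrable_gaussianReal_iff.1 (integrable_of_abs_le_exp hm' hh')
  have i2 := integrable_gaussianReal_iff.1
    (integrable_of_abs_le_exp (measurable_id.mul hm) hxh)
  have key := integral_mul_deriv_eq_deriv_mul_of_integrable (u := h) (u' := h')
    (v := gaussianPDFReal 0 1) (v' := fun x => -(gaussianPDFReal 0 1 x * x))
    (fun x _ => hd x) (fun x _ => hasDerivAt_gaussianPDFReal x)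
    (i2.neg.congr (ae_of_all _ fun x => by simp; ring))
    (i1.congr (ae_of_all _ fun x => by simp; ring))
    (i0.congr (ae_of_all _ fun x => by simp; ring))
  rw [integral_gaussianReal_eq_integral_smul one_ne_zero,
    integral_gaussianReal_eq_integral_smul one_ne_zero]
  simp only [smul_eq_mul]
  have e1 : ∀ x, h x * -(gaussianPDFReal 0 1 x * x) = -(gaussianPDFReal 0 1 x * (x * h x)) := by
    intro x; ring
  simp only [e1, integral_neg, neg_inj] at key
  rw [key]
  simp only [mul_comm]

end OneDim

/-! ### Integration by parts in several variables. -/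

section MultiDim

variable {ι : Type*} [Fintype ι]

lemma integrable_exp_sum_abs (c : ℝ) :
    Integrable (fun w : ι → ℝ => exp (c * ∑ k, |w k|)) (stdPi ι) := by
  have := Integrable.fintype_prod (ι := ι) (μ := fun _ => gaussianReal 0 1)
    (f := fun _ x => exp (c * |x|)) (fun _ => integrable_exp_mul_abs_gaussian c)
  refine this.congr (ae_of_all _ fun w => ?_)
  simp only [Finset.mul_sum, exp_sum]

lemma ExpGrowth.integrable {f : (ι → ℝ) → ℝ} (hf : ExpGrowth f) (hm : Measurable f) :
    Integrable f (stdPi ι) := by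
  obtain ⟨C, c, h⟩ := hf
  exact ((integrable_exp_sum_abs c).const_mul C).mono' hm.aestronglyMeasurable (ae_of_all _ h)

lemma ExpGrowth.coord_mul {f : (ι → ℝ) → ℝ} (hf : ExpGrowth f) (k : ι) :
    ExpGrowth fun w => w k * f w := by
  obtain ⟨C, c, h⟩ := hf
  refine ⟨C, c + 1, fun w => ?_⟩
  have h1 : |w k| ≤ exp (∑ k, |w k|) := by
    have := Finset.single_le_sum (f := fun k => |w k|) (fun i _ => abs_nonneg _)
      (Finset.mem_univ k)
    linarith [add_one_le_exp (∑ k, |w k|)]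
  calc |w k * f w| = |w k| * |f w| := abs_mul _ _
    _ ≤ exp (∑ k, |w k|) * (C * exp (c * ∑ k, |w k|)) := by gcongr; exact h w
    _ = C * exp ((c + 1) * ∑ k, |w k|) := by rw [add_mul, exp_add]; ring_nf

/-- Resampling one coordinate independently leaves the law unchanged. Through Fubini, this reduces
integration by parts in coordinate `k` to the one-dimensional case. -/
lemma map_update_stdPi [DecidableEq ι] (k : ι) :
    ((gaussianReal 0 1).prod (stdPi ι)).map (fun p => Function.update p.2 k p.1) = stdPi ι := by
  have hmeas : Measurable fun p : ℝ × (ι → ℝ) => Function.update p.2 k p.1 :=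
    measurable_pi_iff.2 fun i => by
      by_cases h : i = k
      · subst h; simpa using measurable_fst
      · simp only [Function.update_of_ne h]; fun_prop
  refine (Measure.pi_eq fun s hs => ?_).symm
  rw [Measure.map_apply hmeas (MeasurableSet.univ_pi hs)]
  have : (fun p : ℝ × (ι → ℝ) => Function.update p.2 k p.1) ⁻¹' (Set.univ.pi s) =
      s k ×ˢ Set.univ.pi (Function.update s k Set.univ) := by
    ext ⟨x, w⟩
    simp only [Set.mem_preimage, Set.mem_pi, Set.mem_univ, true_implies, Set.mem_prod]
    constructor
    · intro h
      refine ⟨by simpa using h k, fun i => ?_⟩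
      by_cases hi : i = k
      · subst hi; simp
      · simpa [hi] using h i
    · rintro ⟨h1, h2⟩ i
      by_cases hi : i = k
      · subst hi; simpa using h1
      · simpa [hi] using h2 i
  rw [this, Measure.prod_prod, Measure.pi_pi, ← Finset.mul_prod_erase _ _ (Finset.mem_univ k),
    ← Finset.mul_prod_erase _ (fun i => gaussianReal 0 1 (s i)) (Finset.mem_univ k)]
  simp only [Function.update_self, measure_univ, one_mul]
  congr 1
  refine Finset.prod_congr rfl fun i hi => ?_
  rw [Function.update_of_ne (Finset.ne_of_mem_erase hi)]

lemma sum_abs_update_le [DecidableEq ι] (w : ι → ℝ) (k : ι) (x : ℝ) :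
    ∑ i, |Function.update w k x i| ≤ |x| + ∑ i, |w i| := by
  rw [← Finset.add_sum_erase _ _ (Finset.mem_univ k),
    ← Finset.add_sum_erase _ (fun i => |w i|) (Finset.mem_univ k), Function.update_self]
  have : ∑ i ∈ Finset.univ.erase k, |Function.update w k x i| =
      ∑ i ∈ Finset.univ.erase k, |w i| := Finset.sum_congr rfl fun i hi => by
    rw [Function.update_of_ne (Finset.ne_of_mem_erase hi)]
  rw [this]
  linarith [abs_nonneg (w k)]

/-- Gaussian integration by parts. -/
lemma gaussian_ibp [DecidableEq ι] (k : ι) {f f' : (ι → ℝ) → ℝ} (hm : Measurable f)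
    (hm' : Measurable f') (hf : ExpGrowth f) (hf' : ExpGrowth f')
    (hd : ∀ w x, HasDerivAt (fun x => f (Function.update w k x)) (f' (Function.update w k x)) x) :
    ∫ w, w k * f w ∂(stdPi ι) = ∫ w, f' w ∂(stdPi ι) := by
  have hmeas : Measurable fun p : ℝ × (ι → ℝ) => Function.update p.2 k p.1 :=
    measurable_pi_iff.2 fun i => by
      by_cases h : i = k
      · subst h; simpa using measurable_fst
      · simp only [Function.update_of_ne h]; fun_prop
  have hmk : Measurable fun w : ι → ℝ => w k * f w := (measurable_pi_apply k).mul hm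
  have i1 := (hf.coord_mul k).integrable hmk
  have i2 := hf'.integrable hm'
  rw [← map_update_stdPi k] at i1 i2 ⊢
  rw [integral_map hmeas.aemeasurable hmk.aestronglyMeasurable,
    integral_map hmeas.aemeasurable hm'.aestronglyMeasurable]
  rw [integrable_map_measure hmk.aestronglyMeasurable hmeas.aemeasurable] at i1
  rw [integrable_map_measure hm'.aestronglyMeasurable hmeas.aemeasurable] at i2
  refine (integral_prod_symm _ i1).trans (Eq.trans ?_ (integral_prod_symm _ i2).symm)
  refine integral_congr_ae (ae_of_all _ fun w => ?_)
  simp only [Function.update_self, Function.comp]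
  obtain ⟨C, c, h⟩ := hf
  obtain ⟨C', c', h'⟩ := hf'
  -- With `w` frozen, the growth bound becomes a one-dimensional one in `x`, with a constant
  -- depending on `w`; the maxima give both functions the same constants.
  have aux : ∀ (C c D d : ℝ) (x : ℝ), C * exp (c * ∑ i, |Function.update w k x i|) ≤
      (max |C| |D| * exp (max |c| |d| * ∑ i, |w i|)) * exp (max |c| |d| * |x|) := by
    intro C c D d x
    have hs : 0 ≤ ∑ i, |Function.update w k x i| := Finset.sum_nonneg fun _ _ => abs_nonneg _
    rw [mul_assoc, ← exp_add, ← mul_add, add_comm]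
    gcongr
    · exact (le_abs_self C).trans (le_max_left _ _)
    · exact (le_abs_self c).trans (le_max_left _ _)
    · exact sum_abs_update_le w k x
  refine gaussian_ibp_one (hd w) (C := max |C| |C'| * exp (max |c| |c'| * ∑ i, |w i|))
    (c := max |c| |c'|) (fun x => (h _).trans (aux _ _ _ _ _)) fun x => (h' _).trans ?_
  rw [max_comm |C|, max_comm |c|]
  exact aux _ _ _ _ _

end MultiDim

/-! ### Growth classes, uniform in a parameter, used for integrability and for domination. -/

section Growth

variable {ι Θ κ : Type*} [Fintype ι]

/-- `f θ` grows at most exponentially, uniformly in the parameter `θ`. -/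
def UExpGrowth (f : Θ → (ι → ℝ) → ℝ) : Prop :=
  ∃ c : ℝ, 0 ≤ c ∧ ∀ θ w, |f θ w| ≤ exp (c * (1 + ∑ k, |w k|))

/-- `f θ` is positive and its logarithm grows at most linearly, uniformly in `θ`. -/
def ULogGrowth (f : Θ → (ι → ℝ) → ℝ) : Prop :=
  (∀ θ w, 0 < f θ w) ∧ ∃ c : ℝ, 0 ≤ c ∧ ∀ θ w, |log (f θ w)| ≤ c * (1 + ∑ k, |w k|)

lemma one_le_one_add_sum_abs (w : ι → ℝ) : 1 ≤ 1 + ∑ k, |w k| := by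
  linarith [Finset.sum_nonneg (s := Finset.univ) fun (k : ι) _ => abs_nonneg (w k)]

lemma UExpGrowth.expGrowth {f : Θ → (ι → ℝ) → ℝ} (hf : UExpGrowth f) (θ : Θ) :
    ExpGrowth (f θ) := by
  obtain ⟨c, -, h⟩ := hf
  refine ⟨exp c, c, fun w => (h θ w).trans_eq ?_⟩
  rw [← exp_add]; ring_nf

lemma UExpGrowth.mul {f g : Θ → (ι → ℝ) → ℝ} (hf : UExpGrowth f) (hg : UExpGrowth g) :
    UExpGrowth fun θ w => f θ w * g θ w := by
  obtain ⟨c, hc, h⟩ := hf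
  obtain ⟨d, hd, h'⟩ := hg
  refine ⟨c + d, by positivity, fun θ w => ?_⟩
  rw [abs_mul, add_mul, exp_add]
  exact mul_le_mul (h _ _) (h' _ _) (abs_nonneg _) (exp_pos _).le

lemma UExpGrowth.add {f g : Θ → (ι → ℝ) → ℝ} (hf : UExpGrowth f) (hg : UExpGrowth g) :
    UExpGrowth fun θ w => f θ w + g θ w := by
  obtain ⟨c, hc, h⟩ := hf
  obtain ⟨d, hd, h'⟩ := hg
  refine ⟨max c d + 1, by positivity, fun θ w => (abs_add_le _ _).trans ?_⟩
  have hS := one_le_one_add_sum_abs w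
  set S := 1 + ∑ k, |w k|
  have e1 : (2 : ℝ) ≤ exp S := by linarith [add_one_le_exp S]
  have e2 : |f θ w| ≤ exp (max c d * S) := (h θ w).trans (by gcongr; exact le_max_left _ _)
  have e3 : |g θ w| ≤ exp (max c d * S) := (h' θ w).trans (by gcongr; exact le_max_right _ _)
  rw [add_mul, exp_add, one_mul]
  nlinarith [exp_pos (max c d * S)]

lemma UExpGrowth.of_bounded {f : Θ → (ι → ℝ) → ℝ} {C : ℝ} (h : ∀ θ w, |f θ w| ≤ C) :
    UExpGrowth f := by
  refine ⟨|C|, abs_nonneg _, fun θ w => (h θ w).trans ?_⟩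
  have hS := one_le_one_add_sum_abs w
  have := add_one_le_exp (|C| * (1 + ∑ k, |w k|))
  nlinarith [le_abs_self C, abs_nonneg C]

lemma UExpGrowth.const (C : ℝ) : UExpGrowth fun (_ : Θ) (_ : ι → ℝ) => C :=
  .of_bounded fun _ _ => le_rfl

lemma UExpGrowth.sum (s : Finset κ) {f : κ → Θ → (ι → ℝ) → ℝ} (hf : ∀ i, UExpGrowth (f i)) :
    UExpGrowth fun θ w => ∑ i ∈ s, f i θ w := by
  classical
  induction s using Finset.induction_on with
  | empty => simpa using UExpGrowth.const 0
  | insert i s hi ih => simpa only [Finset.sum_insert hi] using (hf i).add ih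

lemma UExpGrowth.coord (k : ι) : UExpGrowth fun (_ : Θ) (w : ι → ℝ) => w k := by
  refine ⟨1, zero_le_one, fun θ w => ?_⟩
  have := Finset.single_le_sum (f := fun k => |w k|) (fun i _ => abs_nonneg _) (Finset.mem_univ k)
  have h2 := add_one_le_exp (1 * (1 + ∑ k, |w k|))
  linarith

lemma ULogGrowth.uExpGrowth {f : Θ → (ι → ℝ) → ℝ} (hf : ULogGrowth f) : UExpGrowth f := by
  obtain ⟨hp, c, hc, h⟩ := hf
  refine ⟨c, hc, fun θ w => ?_⟩
  rw [abs_of_pos (hp θ w), ← exp_log (hp θ w)]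
  exact exp_le_exp.2 ((le_abs_self _).trans (h θ w))

lemma ULogGrowth.rpow {f : Θ → (ι → ℝ) → ℝ} (hf : ULogGrowth f) (a : ℝ) :
    ULogGrowth fun θ w => f θ w ^ a := by
  obtain ⟨hp, c, hc, h⟩ := hf
  refine ⟨fun θ w => rpow_pos_of_pos (hp θ w) a, |a| * c, by positivity, fun θ w => ?_⟩
  rw [log_rpow (hp θ w), abs_mul, mul_assoc]
  gcongr
  exact h θ w

/-- A sum of positive terms lies between any one term and the number of terms times a common upper
bound. The two-sided control of the logarithm is what lets negative powers of sums stay in the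
class. -/
lemma ULogGrowth.sum [Fintype κ] [Nonempty κ] {f : κ → Θ → (ι → ℝ) → ℝ}
    (hf : ∀ i, ULogGrowth (f i)) : ULogGrowth fun θ w => ∑ i, f i θ w := by
  choose hp c hc h using hf
  have hpos : ∀ θ w, 0 < ∑ i, f i θ w := fun θ w =>
    Finset.sum_pos (fun i _ => hp i θ w) Finset.univ_nonempty
  refine ⟨hpos, Fintype.card κ + ∑ i, c i,
    add_nonneg (Nat.cast_nonneg _) (Finset.sum_nonneg fun i _ => hc i), fun θ w => ?_⟩
  have hS := one_le_one_add_sum_abs w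
  set S := 1 + ∑ k, |w k|
  have hci : ∀ i, c i ≤ ∑ i, c i := fun i =>
    Finset.single_le_sum (fun i _ => hc i) (Finset.mem_univ i)
  have hcard : (0 : ℝ) < Fintype.card κ := Nat.cast_pos.2 Fintype.card_pos
  rw [abs_le]
  constructor
  · obtain ⟨i⟩ := ‹Nonempty κ›
    have h1 : log (f i θ w) ≤ log (∑ i, f i θ w) :=
      log_le_log (hp i θ w) (Finset.single_le_sum (f := fun i => f i θ w)
        (fun i _ => (hp i θ w).le) (Finset.mem_univ i))
    have h2 := (abs_le.1 (h i θ w)).1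
    nlinarith [hci i]
  · have h1 : ∑ i, f i θ w ≤ Fintype.card κ * exp ((∑ i, c i) * S) := by
      rw [← nsmul_eq_mul, Fintype.card, ← Finset.sum_const]
      refine Finset.sum_le_sum fun i _ => ?_
      rw [← exp_log (hp i θ w)]
      refine exp_le_exp.2 ((le_abs_self _).trans ?_)
      exact (h i θ w).trans (by gcongr; exact hci i)
    have h2 := log_le_log (hpos θ w) h1
    rw [log_mul hcard.ne' (exp_pos _).ne', log_exp] at h2
    have h3 := log_le_sub_one_of_pos hcard
    nlinarith

lemma ULogGrowth.exp_of_linear {ℓ : Θ → (ι → ℝ) → ℝ} {A : Θ → ι → ℝ} {c : ℝ}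
    (hA : ∀ θ k, |A θ k| ≤ c) (h : ∀ θ w, ℓ θ w = ∑ k, A θ k * w k) :
    ULogGrowth fun θ w => exp (ℓ θ w) := by
  refine ⟨fun θ w => exp_pos _, |c|, abs_nonneg _, fun θ w => ?_⟩
  rw [log_exp, h]
  refine (Finset.abs_sum_le_sum_abs _ _).trans ?_
  rw [mul_add, Finset.mul_sum]
  have : ∑ k, |A θ k * w k| ≤ ∑ k, |c| * |w k| := Finset.sum_le_sum fun k _ => by
    rw [abs_mul]
    exact mul_le_mul_of_nonneg_right ((hA θ k).trans (le_abs_self c)) (abs_nonneg _)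
  linarith [abs_nonneg c]

end Growth

/-! ### The smooth min-max functional and its first two derivatives. -/

section SoftMinMax

variable {U V : Type*} [Fintype V]

/-- The smooth min-max functional `(∑ᵤ (∑ᵥ exp xᵤᵥ)ᵃ)ᵇ`. -/
noncomputable def softF [Fintype U] (a b : ℝ) (x : U → V → ℝ) : ℝ := (∑ u, (∑ v, exp (x u v)) ^ a) ^ b

/-- The partial derivatives of `softF`. -/
noncomputable def softP [Fintype U] (a b : ℝ) (x : U → V → ℝ) (u : U) (v : V) : ℝ :=
  a * b * ((∑ u, (∑ v, exp (x u v)) ^ a) ^ (b - 1) *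
    ((∑ v, exp (x u v)) ^ (a - 1) * exp (x u v)))

/-- The derivative of `softP` in the direction `y`. -/
noncomputable def softDP [Fintype U] (a b : ℝ) (x y : U → V → ℝ) (u : U) (v : V) : ℝ :=
  a * b * ((b - 1) * (∑ u, (∑ v, exp (x u v)) ^ a) ^ (b - 2) *
      (a * ∑ u', (∑ v, exp (x u' v)) ^ (a - 1) * ∑ v, exp (x u' v) * y u' v) *
      ((∑ v, exp (x u v)) ^ (a - 1) * exp (x u v)) +
    (a - 1) * (∑ u, (∑ v, exp (x u v)) ^ a) ^ (b - 1) *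
      (∑ v, exp (x u v)) ^ (a - 2) * (∑ v, exp (x u v) * y u v) * exp (x u v) +
    (∑ u, (∑ v, exp (x u v)) ^ a) ^ (b - 1) * (∑ v, exp (x u v)) ^ (a - 1) *
      exp (x u v) * y u v)

lemma softZ_pos [Nonempty V] (x : U → V → ℝ) (u : U) : 0 < ∑ v, exp (x u v) :=
  Finset.sum_pos (fun _ _ => exp_pos _) Finset.univ_nonempty

lemma softW_pos [Fintype U] [Nonempty U] [Nonempty V] (a : ℝ) (x : U → V → ℝ) : 0 < ∑ u, (∑ v, exp (x u v)) ^ a :=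
  Finset.sum_pos (fun u _ => rpow_pos_of_pos (softZ_pos x u) a) Finset.univ_nonempty

lemma softF_pos [Fintype U] [Nonempty U] [Nonempty V] (a b : ℝ) (x : U → V → ℝ) : 0 < softF a b x := rpow_pos_of_pos (softW_pos a x) b

lemma hasDerivAt_softW [Fintype U] [Nonempty V] (a : ℝ) {x : ℝ → U → V → ℝ} {y : U → V → ℝ} {s : ℝ}
    (hx : ∀ u v, HasDerivAt (fun t => x t u v) (y u v) s) :
    HasDerivAt (fun t => ∑ u, (∑ v, exp (x t u v)) ^ a)
      (a * ∑ u, (∑ v, exp (x s u v)) ^ (a - 1) * ∑ v, exp (x s u v) * y u v) s := by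
  have hZ : ∀ u, HasDerivAt (fun t => ∑ v, exp (x t u v)) (∑ v, exp (x s u v) * y u v) s :=
    fun u => HasDerivAt.fun_sum fun v _ => (hx u v).exp
  refine (HasDerivAt.fun_sum fun u _ =>
    (hZ u).rpow_const (p := a) (Or.inl (softZ_pos (x s) u).ne')).congr_deriv ?_
  rw [Finset.mul_sum]
  exact Finset.sum_congr rfl fun u _ => by ring

lemma hasDerivAt_softF [Fintype U] [Nonempty U] [Nonempty V] (a b : ℝ) {x : ℝ → U → V → ℝ} {y : U → V → ℝ} {s : ℝ}
    (hx : ∀ u v, HasDerivAt (fun t => x t u v) (y u v) s) :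
    HasDerivAt (fun t => softF a b (x t)) (∑ u, ∑ v, softP a b (x s) u v * y u v) s := by
  refine ((hasDerivAt_softW a hx).rpow_const (p := b)
    (Or.inl (softW_pos a (x s)).ne')).congr_deriv ?_
  simp only [softP, Finset.mul_sum, Finset.sum_mul]
  exact Finset.sum_congr rfl fun u _ => Finset.sum_congr rfl fun v _ => by ring

lemma hasDerivAt_softP [Fintype U] [Nonempty U] [Nonempty V] (a b : ℝ) {x : ℝ → U → V → ℝ} {y : U → V → ℝ} {s : ℝ}
    (hx : ∀ u v, HasDerivAt (fun t => x t u v) (y u v) s) (u : U) (v : V) :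
    HasDerivAt (fun t => softP a b (x t) u v) (softDP a b (x s) y u v) s := by
  have hW := (hasDerivAt_softW a hx).rpow_const (p := b - 1) (Or.inl (softW_pos a (x s)).ne')
  have hZ : HasDerivAt (fun t => ∑ v, exp (x t u v)) (∑ v, exp (x s u v) * y u v) s :=
    HasDerivAt.fun_sum fun v _ => (hx u v).exp
  have hZ' := hZ.rpow_const (p := a - 1) (Or.inl (softZ_pos (x s) u).ne')
  refine ((hW.fun_mul (hZ'.fun_mul (hx u v).exp)).const_mul (a * b)).congr_deriv ?_
  rw [softDP, show b - 1 - 1 = b - 2 by ring, show a - 1 - 1 = a - 2 by ring]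
  ring

/-- Linearity in the direction: it lets the sum over Gaussian coordinates produced by integration by
parts collapse into a single direction made of covariances. -/
lemma softDP_sum [Fintype U] {κ : Type*} (s : Finset κ) (a b : ℝ) (x : U → V → ℝ) (c : κ → ℝ)
    (y : κ → U → V → ℝ) (u : U) (v : V) :
    ∑ k ∈ s, c k * softDP a b x (y k) u v =
      softDP a b x (fun u v => ∑ k ∈ s, c k * y k u v) u v := by
  have e1 : ∀ u, ∑ v, exp (x u v) * ∑ k ∈ s, c k * y k u v =
      ∑ k ∈ s, c k * ∑ v, exp (x u v) * y k u v := by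
    intro u
    simp only [Finset.mul_sum]
    rw [Finset.sum_comm]
    exact Finset.sum_congr rfl fun k _ => Finset.sum_congr rfl fun v _ => by ring
  have e2 : ∑ u', (∑ v, exp (x u' v)) ^ (a - 1) * ∑ v, exp (x u' v) * ∑ k ∈ s, c k * y k u' v =
      ∑ k ∈ s, c k * ∑ u', (∑ v, exp (x u' v)) ^ (a - 1) * ∑ v, exp (x u' v) * y k u' v := by
    simp only [e1]
    simp only [Finset.mul_sum]
    rw [Finset.sum_comm]
    exact Finset.sum_congr rfl fun k _ => Finset.sum_congr rfl fun u _ =>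
      Finset.sum_congr rfl fun v _ => by ring
  simp only [softDP]
  rw [e1, e2]
  simp only [Finset.mul_sum (s := s), Finset.sum_mul (s := s), ← Finset.sum_add_distrib]
  refine Finset.sum_congr rfl fun k _ => ?_
  ring

/-- Vanishing of `y` on row `u` kills the terms that differentiate the inner sum or the exponential
of that row. What remains carries the factor `a²b(b-1) ≤ 0`, whatever the sign of `a`; hence one
comparison serves both min-max and max-max. -/
lemma softDP_nonpos [Fintype U] [Nonempty U] [Nonempty V] {a b : ℝ} (hb : 0 ≤ b) (hb1 : b ≤ 1) (x : U → V → ℝ) {y : U → V → ℝ}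
    {u : U} (hy : ∀ u v, 0 ≤ y u v) (hy0 : ∀ v, y u v = 0) (v : V) :
    softDP a b x y u v ≤ 0 := by
  simp only [softDP, hy0, mul_zero, Finset.sum_const_zero, zero_mul, add_zero]
  have hW := softW_pos a x
  have h1 : 0 ≤ ∑ u', (∑ v, exp (x u' v)) ^ (a - 1) * ∑ v, exp (x u' v) * y u' v :=
    Finset.sum_nonneg fun u' _ => mul_nonneg (rpow_nonneg (softZ_pos x u').le _)
      (Finset.sum_nonneg fun v _ => mul_nonneg (exp_pos _).le (hy _ _))
  have h2 : 0 ≤ (∑ v, exp (x u v)) ^ (a - 1) * exp (x u v) :=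
    mul_nonneg (rpow_nonneg (softZ_pos x u).le _) (exp_pos _).le
  have h3 := rpow_nonneg hW.le (b - 2)
  have h4 : 0 ≤ a ^ 2 * (b * (1 - b)) := by
    have : 0 ≤ 1 - b := by linarith
    positivity
  have h5 := mul_nonneg (mul_nonneg h4 h3) (mul_nonneg h1 h2)
  linarith [h5]

end SoftMinMax

/-! ### Differentiating Gaussian integrals of the functional along a curve of coefficients. -/

section Comparison

variable {U V ι Θ : Type*} [Fintype ι]

/-- The linear process `w ↦ (∑ₖ Aᵤᵥₖ wₖ)ᵤᵥ`. -/
def linProc (A : U → V → ι → ℝ) (w : ι → ℝ) (u : U) (v : V) : ℝ := ∑ k, A u v k * w k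

lemma measurable_linProc (A : U → V → ι → ℝ) (u : U) (v : V) :
    Measurable fun w => linProc A w u v := by
  unfold linProc; fun_prop

lemma uLogGrowth_exp {A : Θ → U → V → ι → ℝ} {c : ℝ} (hA : ∀ θ u v k, |A θ u v k| ≤ c) (u : U)
    (v : V) : ULogGrowth fun θ w => exp (linProc (A θ) w u v) :=
  .exp_of_linear (A := fun θ k => A θ u v k) (fun θ k => hA θ u v k) fun _ _ => rfl

variable [Fintype V]

lemma uLogGrowth_softZ [Nonempty V] {A : Θ → U → V → ι → ℝ} {c : ℝ} (hA : ∀ θ u v k, |A θ u v k| ≤ c) (u : U) :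
    ULogGrowth fun θ w => ∑ v, exp (linProc (A θ) w u v) :=
  .sum fun v => uLogGrowth_exp hA u v

variable [Fintype U]

lemma measurable_softF (a b : ℝ) (A : U → V → ι → ℝ) :
    Measurable fun w => softF a b (linProc A w) := by
  have := measurable_linProc A
  unfold softF; fun_prop

lemma measurable_softP (a b : ℝ) (A : U → V → ι → ℝ) (u : U) (v : V) :
    Measurable fun w => softP a b (linProc A w) u v := by
  have := measurable_linProc A
  unfold softP; fun_prop

lemma measurable_softDP (a b : ℝ) (A : U → V → ι → ℝ) (y : U → V → ℝ) (u : U) (v : V) :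
    Measurable fun w => softDP a b (linProc A w) y u v := by
  have := measurable_linProc A
  unfold softDP; fun_prop

variable [Nonempty U] [Nonempty V]

lemma uLogGrowth_softW (a : ℝ) {A : Θ → U → V → ι → ℝ} {c : ℝ} (hA : ∀ θ u v k, |A θ u v k| ≤ c) :
    ULogGrowth fun θ w => ∑ u, (∑ v, exp (linProc (A θ) w u v)) ^ a :=
  .sum fun u => (uLogGrowth_softZ hA u).rpow a

lemma uLogGrowth_softF (a b : ℝ) {A : Θ → U → V → ι → ℝ} {c : ℝ}
    (hA : ∀ θ u v k, |A θ u v k| ≤ c) : ULogGrowth fun θ w => softF a b (linProc (A θ) w) :=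
  (uLogGrowth_softW a hA).rpow b

lemma uExpGrowth_softP (a b : ℝ) {A : Θ → U → V → ι → ℝ} {c : ℝ}
    (hA : ∀ θ u v k, |A θ u v k| ≤ c) (u : U) (v : V) :
    UExpGrowth fun θ w => softP a b (linProc (A θ) w) u v :=
  (UExpGrowth.const (a * b)).mul
    (((uLogGrowth_softW a hA).rpow (b - 1)).uExpGrowth.mul
      (((uLogGrowth_softZ hA u).rpow (a - 1)).uExpGrowth.mul (uLogGrowth_exp hA u v).uExpGrowth))

lemma uExpGrowth_softDP (a b : ℝ) {A : Θ → U → V → ι → ℝ} {c : ℝ}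
    (hA : ∀ θ u v k, |A θ u v k| ≤ c) (y : U → V → ℝ) (u : U) (v : V) :
    UExpGrowth fun θ w => softDP a b (linProc (A θ) w) y u v := by
  have hW := fun s => ((uLogGrowth_softW a hA).rpow s).uExpGrowth
  have hZ := fun u s => ((uLogGrowth_softZ hA u).rpow s).uExpGrowth
  have hE := fun u v => (uLogGrowth_exp hA u v).uExpGrowth
  have hEy : ∀ u, UExpGrowth fun θ w => ∑ v, exp (linProc (A θ) w u v) * y u v :=
    fun u => .sum _ fun v => (hE u v).mul (.const _)
  unfold softDP
  exact (UExpGrowth.const _).mul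
    ((((((UExpGrowth.const _).mul (hW _)).mul ((UExpGrowth.const _).mul
      (.sum _ fun u' => (hZ u' _).mul (hEy u')))).mul ((hZ u _).mul (hE u v))).add
      (((((UExpGrowth.const _).mul (hW _)).mul (hZ u _)).mul (hEy u)).mul (hE u v))).add
      ((((hW _).mul (hZ u _)).mul (hE u v)).mul (.const _)))

lemma integrable_softF (a b : ℝ) (A : U → V → ι → ℝ) :
    Integrable (fun w => softF a b (linProc A w)) (stdPi ι) := by
  obtain ⟨c, hc⟩ : ∃ c, ∀ u v k, |A u v k| ≤ c :=
    ⟨∑ u, ∑ v, ∑ k, |A u v k|, fun u v k =>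
      (Finset.single_le_sum (f := fun k => |A u v k|) (fun _ _ => abs_nonneg _)
        (Finset.mem_univ k)).trans
      ((Finset.single_le_sum (f := fun v => ∑ k, |A u v k|) (fun _ _ => by positivity)
        (Finset.mem_univ v)).trans
      (Finset.single_le_sum (f := fun u => ∑ v, ∑ k, |A u v k|) (fun _ _ => by positivity)
        (Finset.mem_univ u)))⟩
  exact ((uLogGrowth_softF a b (Θ := Unit) (A := fun _ => A)
    (fun _ => hc)).uExpGrowth.expGrowth ()).integrable (measurable_softF a b A)

lemma integral_softP_mul_coord [DecidableEq ι] (a b : ℝ) {A : Θ → U → V → ι → ℝ} {c : ℝ}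
    (hA : ∀ θ u v k, |A θ u v k| ≤ c) (θ : Θ) (u : U) (v : V) (k : ι) :
    ∫ w, w k * softP a b (linProc (A θ) w) u v ∂(stdPi ι) =
      ∫ w, softDP a b (linProc (A θ) w) (fun u v => A θ u v k) u v ∂(stdPi ι) := by
  refine gaussian_ibp k (measurable_softP a b (A θ) u v) (measurable_softDP a b (A θ) _ u v)
    ((uExpGrowth_softP a b hA u v).expGrowth θ) ((uExpGrowth_softDP a b hA _ u v).expGrowth θ)
    fun w x => ?_
  refine hasDerivAt_softP a b (x := fun x => linProc (A θ) (Function.update w k x)) ?_ u v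
  intro u v
  have h := hasDerivAt_pi.1 (hasDerivAt_update w k x)
  refine (HasDerivAt.fun_sum fun j _ => (h j).const_mul (A θ u v j)).congr_deriv ?_
  simp [Pi.single_apply]

/-- Derivative of the interpolation integral along a curve of coefficient arrays. -/
lemma hasDerivAt_integral_softF [DecidableEq ι] (a b : ℝ) {A A' : ℝ → U → V → ι → ℝ} {c : ℝ}
    (hA : ∀ θ u v k, |A θ u v k| ≤ c) (hA' : ∀ θ u v k, |A' θ u v k| ≤ c)
    (hd : ∀ θ u v k, HasDerivAt (fun θ => A θ u v k) (A' θ u v k) θ) (θ : ℝ) :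
    HasDerivAt (fun θ => ∫ w, softF a b (linProc (A θ) w) ∂(stdPi ι))
      (∫ w, ∑ u, ∑ v, softDP a b (linProc (A θ) w)
        (fun u' v' => ∑ k, A' θ u v k * A θ u' v' k) u v ∂(stdPi ι)) θ := by
  have gP := uExpGrowth_softP a b hA
  have gL : ∀ u v, UExpGrowth fun θ w => linProc (A' θ) w u v := fun u v =>
    .sum _ fun k => (UExpGrowth.of_bounded fun θ _ => hA' θ u v k).mul (.coord k)
  have g : UExpGrowth fun θ w =>
      ∑ u, ∑ v, softP a b (linProc (A θ) w) u v * linProc (A' θ) w u v :=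
    .sum _ fun u => .sum _ fun v => (gP u v).mul (gL u v)
  obtain ⟨C, -, hC⟩ := id g
  have key := hasDerivAt_integral_of_dominated_loc_of_deriv_le (μ := stdPi ι) (x₀ := θ)
    (F := fun θ w => softF a b (linProc (A θ) w))
    (F' := fun θ w => ∑ u, ∑ v, softP a b (linProc (A θ) w) u v * linProc (A' θ) w u v)
    (bound := fun w => exp (C * (1 + ∑ k, |w k|))) univ_mem
    (Eventually.of_forall fun t => (measurable_softF a b (A t)).aestronglyMeasurable)
    (integrable_softF a b (A θ))
    (Measurable.aestronglyMeasurable <| by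
      have h1 := measurable_softP a b (A θ)
      have h2 := measurable_linProc (A' θ)
      fun_prop)
    (ae_of_all _ fun w t _ => hC t w)
    (((integrable_exp_sum_abs C).const_mul (exp C)).congr (ae_of_all _ fun w => by
      simp only [← exp_add]; ring_nf))
    (ae_of_all _ fun w t _ => hasDerivAt_softF a b (x := fun t => linProc (A t) w)
      fun u v => by
        exact HasDerivAt.fun_sum fun k _ => (hd t u v k).mul_const (w k))
  refine key.2.congr_deriv ?_
  have i1 : ∀ u v k, Integrable
      (fun w => A' θ u v k * (w k * softP a b (linProc (A θ) w) u v)) (stdPi ι) := fun u v k =>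
    ((((gP u v).expGrowth θ).coord_mul k).integrable
      ((measurable_pi_apply k).mul (measurable_softP a b (A θ) u v))).const_mul _
  have i2 : ∀ u v k, Integrable (fun w => A' θ u v k *
      softDP a b (linProc (A θ) w) (fun u v => A θ u v k) u v) (stdPi ι) := fun u v k =>
    (((uExpGrowth_softDP a b hA _ u v).expGrowth θ).integrable
      (measurable_softDP a b (A θ) _ u v)).const_mul _
  calc ∫ w, ∑ u, ∑ v, softP a b (linProc (A θ) w) u v * linProc (A' θ) w u v ∂(stdPi ι)
      = ∫ w, ∑ u, ∑ v, ∑ k, A' θ u v k * (w k * softP a b (linProc (A θ) w) u v) ∂(stdPi ι) := by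
        refine integral_congr_ae (ae_of_all _ fun w => ?_)
        simp only [linProc, Finset.mul_sum]
        exact Finset.sum_congr rfl fun u _ => Finset.sum_congr rfl fun v _ =>
          Finset.sum_congr rfl fun k _ => by ring
    _ = ∑ u, ∑ v, ∑ k, A' θ u v k * ∫ w, w k * softP a b (linProc (A θ) w) u v ∂(stdPi ι) := by
        rw [integral_finsetSum _ fun u _ => integrable_finsetSum _ fun v _ =>
          integrable_finsetSum _ fun k _ => i1 u v k]
        refine Finset.sum_congr rfl fun u _ => ?_
        rw [integral_finsetSum _ fun v _ => integrable_finsetSum _ fun k _ => i1 u v k]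
        refine Finset.sum_congr rfl fun v _ => ?_
        rw [integral_finsetSum _ fun k _ => i1 u v k]
        exact Finset.sum_congr rfl fun k _ => integral_const_mul _ _
    _ = ∑ u, ∑ v, ∑ k, A' θ u v k *
          ∫ w, softDP a b (linProc (A θ) w) (fun u v => A θ u v k) u v ∂(stdPi ι) := by
        simp only [integral_softP_mul_coord a b hA θ]
    _ = ∫ w, ∑ u, ∑ v, ∑ k, A' θ u v k *
          softDP a b (linProc (A θ) w) (fun u v => A θ u v k) u v ∂(stdPi ι) := by
        rw [integral_finsetSum _ fun u _ => integrable_finsetSum _ fun v _ =>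
          integrable_finsetSum _ fun k _ => i2 u v k]
        refine Finset.sum_congr rfl fun u _ => ?_
        rw [integral_finsetSum _ fun v _ => integrable_finsetSum _ fun k _ => i2 u v k]
        refine Finset.sum_congr rfl fun v _ => ?_
        rw [integral_finsetSum _ fun k _ => i2 u v k]
        exact Finset.sum_congr rfl fun k _ => (integral_const_mul _ _).symm
    _ = _ := by
        refine integral_congr_ae (ae_of_all _ fun w => ?_)
        simp only [softDP_sum]

end Comparison

/-! ### Independent blocks and Gordon's interpolation. -/

section Blocks

variable {κ₁ κ₂ : Type*} [Fintype κ₁] [Fintype κ₂]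

lemma measurePreserving_sumElim :
    MeasurePreserving (fun p : (κ₁ → ℝ) × (κ₂ → ℝ) => Sum.elim p.1 p.2)
      ((stdPi κ₁).prod (stdPi κ₂)) (stdPi (κ₁ ⊕ κ₂)) := by
  have hm : Measurable fun p : (κ₁ → ℝ) × (κ₂ → ℝ) => (Sum.elim p.1 p.2 : κ₁ ⊕ κ₂ → ℝ) :=
    measurable_pi_iff.2 fun i => by
      cases i <;> simp <;> fun_prop
  refine ⟨hm, (Measure.pi_eq fun s hs => ?_).symm⟩
  rw [Measure.map_apply hm (MeasurableSet.univ_pi hs)]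
  have : (fun p : (κ₁ → ℝ) × (κ₂ → ℝ) => (Sum.elim p.1 p.2 : κ₁ ⊕ κ₂ → ℝ)) ⁻¹' (Set.univ.pi s) =
      Set.univ.pi (fun i => s (.inl i)) ×ˢ Set.univ.pi (fun i => s (.inr i)) := by
    ext ⟨x, y⟩
    simp [Set.mem_pi]
  rw [this, Measure.prod_prod, Measure.pi_pi, Measure.pi_pi, Fintype.prod_sum_type]

lemma integral_stdPi_sum {f : (κ₁ ⊕ κ₂ → ℝ) → ℝ} (hf : Measurable f) :
    ∫ w, f w ∂(stdPi (κ₁ ⊕ κ₂)) =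
      ∫ p, f (Sum.elim p.1 p.2) ∂((stdPi κ₁).prod (stdPi κ₂)) := by
  rw [← measurePreserving_sumElim.map_eq, integral_map measurePreserving_sumElim.aemeasurable
    hf.aestronglyMeasurable]

lemma integral_stdPi_sum_mul {f : (κ₁ → ℝ) → ℝ} {g : (κ₂ → ℝ) → ℝ} (hf : Measurable f)
    (hg : Measurable g) :
    ∫ w, f (fun i => w (.inl i)) * g (fun i => w (.inr i)) ∂(stdPi (κ₁ ⊕ κ₂)) =
      (∫ w, f w ∂(stdPi κ₁)) * ∫ w, g w ∂(stdPi κ₂) := by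
  rw [integral_stdPi_sum (by fun_prop)]
  exact integral_prod_mul f g

lemma integral_stdPi_sum_inl {f : (κ₁ → ℝ) → ℝ} (hf : Measurable f) :
    ∫ w, f (fun i => w (.inl i)) ∂(stdPi (κ₁ ⊕ κ₂)) = ∫ w, f w ∂(stdPi κ₁) := by
  simpa using integral_stdPi_sum_mul (κ₂ := κ₂) hf (g := fun _ => 1) measurable_const

lemma integral_stdPi_sum_inr {f : (κ₂ → ℝ) → ℝ} (hf : Measurable f) :
    ∫ w, f (fun i => w (.inr i)) ∂(stdPi (κ₁ ⊕ κ₂)) = ∫ w, f w ∂(stdPi κ₂) := by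
  simpa using integral_stdPi_sum_mul (κ₁ := κ₁) (f := fun _ => 1) measurable_const hf

variable {U V : Type*} [Fintype U] [Fintype V] [Nonempty U] [Nonempty V]

/-- **Gordon's comparison inequality** for the smooth min-max functional. -/
lemma integral_softF_le {a b : ℝ} (hb : 0 ≤ b) (hb1 : b ≤ 1) (B : U → V → κ₁ → ℝ)
    (C : U → V → κ₂ → ℝ)
    (hcov : ∀ u v u' v', ∑ k, C u v k * C u' v' k ≤ ∑ k, B u v k * B u' v' k)
    (hcov0 : ∀ u v v', ∑ k, C u v k * C u v' k = ∑ k, B u v k * B u v' k) :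
    ∫ w, softF a b (linProc B w) ∂(stdPi κ₁) ≤ ∫ w, softF a b (linProc C w) ∂(stdPi κ₂) := by
  classical
  -- The path `sin θ · B + cos θ · C` on independent blocks runs from `C` at `0` to `B` at `π/2`.
  -- The covariance of its derivative with itself is `sin θ cos θ` times the difference of the two
  -- covariances.
  let A : ℝ → U → V → κ₁ ⊕ κ₂ → ℝ := fun θ u v =>
    Sum.elim (fun k => sin θ * B u v k) (fun k => cos θ * C u v k)
  let A' : ℝ → U → V → κ₁ ⊕ κ₂ → ℝ := fun θ u v =>
    Sum.elim (fun k => cos θ * B u v k) (fun k => -sin θ * C u v k)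
  obtain ⟨c, hc⟩ : ∃ c, ∀ q : U × V × (κ₁ ⊕ κ₂),
      |Sum.elim (B q.1 q.2.1) (C q.1 q.2.1) q.2.2| ≤ c := by
    obtain ⟨c, hc⟩ := Finite.bddAbove_range fun q : U × V × (κ₁ ⊕ κ₂) =>
      |Sum.elim (B q.1 q.2.1) (C q.1 q.2.1) q.2.2|
    exact ⟨c, fun q => hc ⟨q, rfl⟩⟩
  have hmul : ∀ s x : ℝ, |s| ≤ 1 → |x| ≤ c → |s * x| ≤ c := fun s x hs hx => by
    rw [abs_mul]; exact (mul_le_of_le_one_left (abs_nonneg x) hs).trans hx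
  have hA : ∀ θ u v k, |A θ u v k| ≤ c := by
    rintro θ u v (k | k)
    · exact hmul _ _ (abs_sin_le_one θ) (hc (u, v, .inl k))
    · exact hmul _ _ (abs_cos_le_one θ) (hc (u, v, .inr k))
  have hA' : ∀ θ u v k, |A' θ u v k| ≤ c := by
    rintro θ u v (k | k)
    · exact hmul _ _ (abs_cos_le_one θ) (hc (u, v, .inl k))
    · exact hmul _ _ (by rw [abs_neg]; exact abs_sin_le_one θ) (hc (u, v, .inr k))
  have hd : ∀ θ u v k, HasDerivAt (fun θ => A θ u v k) (A' θ u v k) θ := by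
    rintro θ u v (k | k)
    · exact (hasDerivAt_sin θ).mul_const _
    · exact (hasDerivAt_cos θ).mul_const _
  have hder := hasDerivAt_integral_softF a b hA hA' hd
  have hD : ∀ θ u v u' v', ∑ k, A' θ u v k * A θ u' v' k = sin θ * cos θ *
      (∑ k, B u v k * B u' v' k - ∑ k, C u v k * C u' v' k) := by
    intro θ u v u' v'
    rw [Fintype.sum_sum_type, mul_sub, Finset.mul_sum, Finset.mul_sum, sub_eq_add_neg,
      ← Finset.sum_neg_distrib]
    congr 1
    · exact Finset.sum_congr rfl fun k _ => by simp only [A, A', Sum.elim_inl]; ring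
    · exact Finset.sum_congr rfl fun k _ => by simp only [A, A', Sum.elim_inr]; ring
  have hanti : AntitoneOn (fun θ => ∫ w, softF a b (linProc (A θ) w) ∂(stdPi (κ₁ ⊕ κ₂)))
      (Set.Icc 0 (π / 2)) := by
    refine antitoneOn_of_deriv_nonpos (convex_Icc _ _)
      (fun θ _ => (hder θ).continuousAt.continuousWithinAt)
      (fun θ _ => (hder θ).differentiableAt.differentiableWithinAt) fun θ hθ => ?_
    rw [interior_Icc] at hθ
    rw [(hder θ).deriv]
    have hs : 0 ≤ sin θ * cos θ :=
      mul_nonneg (sin_nonneg_of_nonneg_of_le_pi hθ.1.le (by linarith [hθ.2, pi_pos]))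
        (cos_nonneg_of_neg_pi_div_two_le_of_le (by linarith [hθ.1, pi_pos]) hθ.2.le)
    refine integral_nonpos fun w => Finset.sum_nonpos fun u _ => Finset.sum_nonpos fun v _ => ?_
    refine softDP_nonpos hb hb1 _ (fun u' v' => ?_) (fun v' => ?_) v
    · rw [hD]
      exact mul_nonneg hs (sub_nonneg.2 (hcov u v u' v'))
    · rw [hD, hcov0 u v v', sub_self, mul_zero]
  have h := hanti (Set.left_mem_Icc.2 (by positivity)) (Set.right_mem_Icc.2 (by positivity))
    (by positivity)
  have e1 : ∀ w, linProc (A (π / 2)) w = linProc B fun i => w (.inl i) := by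
    intro w; ext u v; simp [linProc, A]
  have e2 : ∀ w, linProc (A 0) w = linProc C fun i => w (.inr i) := by
    intro w; ext u v; simp [linProc, A]
  simp only [e1, e2] at h
  rwa [integral_stdPi_sum_inl (measurable_softF a b B),
    integral_stdPi_sum_inr (measurable_softF a b C)] at h

end Blocks

/-! ### Exponential moments of the norm of a Gaussian vector. -/

section Chi

lemma integral_exp_mul_gaussian (c : ℝ) : ∫ x, exp (c * x) ∂(gaussianReal 0 1) = exp (c ^ 2 / 2) := by
  have := congrFun (mgf_fun_id_gaussianReal (μ := 0) (v := 1)) c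
  simpa [mgf] using this

lemma gaussianPDFReal_mul_exp_sq (θ x : ℝ) : gaussianPDFReal 0 1 x * exp (θ * x ^ 2) =
    (√(2 * π))⁻¹ * exp (-(1 / 2 - θ) * x ^ 2) := by
  rw [gaussianPDFReal, mul_assoc, ← exp_add]
  simp only [NNReal.coe_one]
  ring_nf

lemma integrable_exp_sq_gaussian {θ : ℝ} (hθ : θ < 1 / 2) :
    Integrable (fun x => exp (θ * x ^ 2)) (gaussianReal 0 1) := by
  rw [integrable_gaussianReal_iff]
  simp only [gaussianPDFReal_mul_exp_sq]
  exact (integrable_exp_neg_mul_sq (by linarith)).const_mul _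

lemma integral_exp_sq_gaussian {θ : ℝ} (hθ : θ < 1 / 2) :
    ∫ x, exp (θ * x ^ 2) ∂(gaussianReal 0 1) = (√(1 - 2 * θ))⁻¹ := by
  rw [integral_gaussianReal_eq_integral_smul one_ne_zero]
  simp only [smul_eq_mul, gaussianPDFReal_mul_exp_sq]
  rw [integral_const_mul, integral_gaussian, ← sqrt_inv, ← sqrt_mul (by positivity), ← sqrt_inv]
  congr 1
  have h1 : 1 / 2 - θ ≠ 0 := by linarith
  have h2 : 1 - 2 * θ ≠ 0 := by linarith
  field_simp

variable {ι : Type*} [Fintype ι]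

lemma integrable_exp_sum_sq {θ : ℝ} (hθ : θ < 1 / 2) :
    Integrable (fun w : ι → ℝ => exp (θ * ∑ k, w k ^ 2)) (stdPi ι) := by
  have := Integrable.fintype_prod (ι := ι) (μ := fun _ => gaussianReal 0 1)
    (f := fun _ x => exp (θ * x ^ 2)) (fun _ => integrable_exp_sq_gaussian hθ)
  refine this.congr (ae_of_all _ fun w => ?_)
  simp only [Finset.mul_sum, exp_sum]

lemma integral_exp_sum_sq {θ : ℝ} (hθ : θ < 1 / 2) :
    ∫ w : ι → ℝ, exp (θ * ∑ k, w k ^ 2) ∂(stdPi ι) = (√(1 - 2 * θ))⁻¹ ^ Fintype.card ι := by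
  simp only [Finset.mul_sum, exp_sum]
  rw [integral_fintype_prod_eq_pow (fun x => exp (θ * x ^ 2)), integral_exp_sq_gaussian hθ]

lemma exp_mul_norm_le (t : ℝ) (w : ι → ℝ) :
    exp (t * √(∑ k, w k ^ 2)) ≤ exp (|t| * ∑ k, |w k|) := by
  have h : √(∑ k, w k ^ 2) ≤ ∑ k, |w k| := by
    refine sqrt_le_iff.2 ⟨by positivity, ?_⟩
    simpa only [sq_abs] using Finset.sum_sq_le_sq_sum_of_nonneg
      (s := Finset.univ) (f := fun k => |w k|) fun _ _ => abs_nonneg _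
  refine exp_le_exp.2 ((mul_le_mul_of_nonneg_right (le_abs_self t) (sqrt_nonneg _)).trans ?_)
  gcongr

lemma integrable_exp_mul_norm (t : ℝ) :
    Integrable (fun w : ι → ℝ => exp (t * √(∑ k, w k ^ 2))) (stdPi ι) :=
  (integrable_exp_sum_abs |t|).mono' (Measurable.aestronglyMeasurable (by fun_prop))
    (ae_of_all _ fun w => by
      rw [norm_of_nonneg (exp_pos _).le]; exact exp_mul_norm_le t w)

/-- Sub-Gaussian upper bound for the norm of a standard Gaussian vector. -/
lemma integral_exp_mul_norm_le {t : ℝ} (ht : 0 < t) :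
    ∫ w : ι → ℝ, exp (t * √(∑ k, w k ^ 2)) ∂(stdPi ι) ≤
      exp (t * √(Fintype.card ι) + t ^ 2 / 2) := by
  rcases isEmpty_or_nonempty ι with h | h
  · simp only [Finset.univ_eq_empty, Finset.sum_empty, sqrt_zero, mul_zero, exp_zero,
      integral_const, probReal_univ, smul_eq_mul, mul_one]
    exact one_le_exp (by positivity)
  set p : ℝ := (Fintype.card ι : ℝ) with hp
  have hp0 : 0 < p := Nat.cast_pos.2 Fintype.card_pos
  have hsq : √p ^ 2 = p := sq_sqrt hp0.le
  -- Use `tr ≤ t²(1+s)/2 + r²/(2(1+s))` and integrate the Gaussian square. The exponent is then at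
  -- most `t²/2 + t²s/2 + p/(2s)`, and this `s` minimizes it.
  set s := √p / t with hs
  have hs0 : 0 < s := by positivity
  have hθ : 1 / (2 * (1 + s)) < 1 / 2 := by
    rw [div_lt_div_iff₀ (by positivity) (by positivity)]; linarith
  have hpt : ∀ w : ι → ℝ, exp (t * √(∑ k, w k ^ 2)) ≤
      exp (t ^ 2 * (1 + s) / 2) * exp (1 / (2 * (1 + s)) * ∑ k, w k ^ 2) := by
    intro w
    rw [← exp_add]
    refine exp_le_exp.2 ?_
    have hr : √(∑ k, w k ^ 2) ^ 2 = ∑ k, w k ^ 2 := sq_sqrt (by positivity)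
    set r := √(∑ k, w k ^ 2)
    rw [← hr]
    have : t ^ 2 * (1 + s) / 2 + 1 / (2 * (1 + s)) * r ^ 2 - t * r =
        (t * (1 + s) - r) ^ 2 / (2 * (1 + s)) := by field_simp; ring
    have h2 : 0 ≤ (t * (1 + s) - r) ^ 2 / (2 * (1 + s)) := by positivity
    linarith
  refine (integral_mono (integrable_exp_mul_norm t)
    ((integrable_exp_sum_sq hθ).const_mul _) hpt).trans ?_
  rw [integral_const_mul, integral_exp_sum_sq hθ]
  have h1 : (√(1 - 2 * (1 / (2 * (1 + s)))))⁻¹ ≤ exp (1 / s / 2) := by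
    rw [← sqrt_inv, show (1 - 2 * (1 / (2 * (1 + s))))⁻¹ = 1 / s + 1 by
      rw [show 1 - 2 * (1 / (2 * (1 + s))) = s / (1 + s) by field_simp; ring]
      field_simp, exp_half]
    exact sqrt_le_sqrt (add_one_le_exp _)
  calc exp (t ^ 2 * (1 + s) / 2) * (√(1 - 2 * (1 / (2 * (1 + s)))))⁻¹ ^ Fintype.card ι
      ≤ exp (t ^ 2 * (1 + s) / 2) * exp (1 / s / 2) ^ Fintype.card ι := by gcongr
    _ = exp (t * √p + t ^ 2 / 2) := by
        rw [← exp_nat_mul, ← exp_add, ← hp]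
        congr 1
        rw [hs]
        have : √p ≠ 0 := by positivity
        field_simp
        linear_combination -hsq

/-- Lower tail of the norm of a standard Gaussian vector, as a bound on the Laplace transform. -/
lemma integral_exp_neg_mul_norm_le {t : ℝ} (ht : 0 < t) (htm : t ≤ √(Fintype.card ι) / 4) :
    ∫ w : ι → ℝ, exp (-t * √(∑ k, w k ^ 2)) ∂(stdPi ι) ≤
      exp (-(t * √(Fintype.card ι))) * (2 + exp (t ^ 2 / 2)) := by
  set M : ℝ := √(Fintype.card ι) with hM
  have hM0 : 0 < M := by linarith
  have hMsq : M ^ 2 = Fintype.card ι := sq_sqrt (Nat.cast_nonneg _)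
  -- Chosen so that `-tM/3 - θr²` equals `-tr` at both `r = M/2` and `r = M`; by concavity it
  -- dominates `-tr` between them.
  set θ := 2 * t / (3 * M) with hθ
  have hθ0 : 0 < θ := by positivity
  have hθM : θ * M = 2 * t / 3 := by rw [hθ]; field_simp
  have hpt : ∀ w : ι → ℝ, exp (-t * √(∑ k, w k ^ 2)) ≤ exp (-(t * M)) +
      (exp (-(t * M / 3)) * exp (-θ * ∑ k, w k ^ 2) +
        exp (M ^ 2 / 4) * exp (-1 * ∑ k, w k ^ 2)) := by
    intro w
    have hr : √(∑ k, w k ^ 2) ^ 2 = ∑ k, w k ^ 2 := sq_sqrt (by positivity)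
    have hr0 : 0 ≤ √(∑ k, w k ^ 2) := sqrt_nonneg _
    set r := √(∑ k, w k ^ 2)
    rw [← hr, ← exp_add, ← exp_add]
    have e1 := exp_pos (-(t * M))
    have e2 := exp_pos (-(t * M / 3) + -θ * r ^ 2)
    have e3 := exp_pos (M ^ 2 / 4 + -1 * r ^ 2)
    rcases le_total M r with h | h
    · have : exp (-t * r) ≤ exp (-(t * M)) := exp_le_exp.2 (by nlinarith)
      linarith
    rcases le_total (M / 2) r with h' | h'
    · have : exp (-t * r) ≤ exp (-(t * M / 3) + -θ * r ^ 2) := by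
        refine exp_le_exp.2 ?_
        have h4 : t = 3 * (θ * M) / 2 := by rw [hθM]; ring
        rw [h4]
        have h3 : 0 ≤ θ * ((M - r) * (r - M / 2)) :=
          mul_nonneg hθ0.le (mul_nonneg (by linarith) (by linarith))
        nlinarith
      linarith
    -- Here the left side is at most `1`, which `r ≤ M/2` bounds by the right side. Integration
    -- costs `3^(-M²/2) ≤ exp(-M²/2)`, leaving `exp(-M²/4) ≤ exp(-tM)` since `t ≤ M/4`.
    · have : exp (-t * r) ≤ exp (M ^ 2 / 4 + -1 * r ^ 2) := by
        refine exp_le_exp.2 ?_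
        have : 0 ≤ t * r := by positivity
        nlinarith
      linarith
  have i1 := (integrable_exp_sum_sq (ι := ι) (θ := -θ) (by linarith)).const_mul
    (exp (-(t * M / 3)))
  have i2 := (integrable_exp_sum_sq (ι := ι) (θ := -1) (by norm_num)).const_mul (exp (M ^ 2 / 4))
  refine (integral_mono (integrable_exp_mul_norm (-t))
    ((integrable_const _).add (i1.add i2)) hpt).trans ?_
  rw [integral_add' (integrable_const _) (i1.add i2), integral_add' i1 i2, integral_const_mul,
    integral_const_mul, integral_exp_sum_sq (by linarith), integral_exp_sum_sq (by norm_num)]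
  simp only [integral_const, probReal_univ, smul_eq_mul, one_mul]
  have b1 : (√(1 - 2 * -θ))⁻¹ ≤ exp (-θ + θ ^ 2) := by
    have h1 : 2 * θ - 2 * θ ^ 2 ≤ log (1 + 2 * θ) := by
      refine le_trans ?_ (le_log_one_add_of_nonneg (x := 2 * θ) (by positivity))
      rw [le_div_iff₀ (by positivity)]
      nlinarith [pow_pos hθ0 3]
    rw [← sqrt_inv, show -θ + θ ^ 2 = (-(2 * θ - 2 * θ ^ 2)) / 2 by ring, exp_half]
    refine sqrt_le_sqrt ?_
    rw [exp_neg, show 1 - 2 * -θ = 1 + 2 * θ by ring]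
    refine inv_anti₀ (exp_pos _) ?_
    rwa [← le_log_iff_exp_le (by positivity)]
  have b2 : (√(1 - 2 * -1))⁻¹ ≤ exp (-(1 / 2)) := by
    rw [← sqrt_inv, show (-(1 / 2) : ℝ) = (-1) / 2 by ring, exp_half]
    refine sqrt_le_sqrt ?_
    rw [exp_neg]
    refine inv_anti₀ (exp_pos _) ?_
    have := exp_one_lt_d9
    norm_num at this ⊢
    linarith
  have c1 : exp (-(t * M / 3)) * (√(1 - 2 * -θ))⁻¹ ^ Fintype.card ι ≤
      exp (-(t * M)) * exp (t ^ 2 / 2) := by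
    refine (mul_le_mul_of_nonneg_left (pow_le_pow_left₀ (by positivity) b1 _)
      (exp_pos _).le).trans ?_
    rw [← exp_nat_mul, ← exp_add, ← exp_add, ← hMsq]
    refine exp_le_exp.2 ?_
    have e : M ^ 2 * (-θ + θ ^ 2) = -(M * (θ * M)) + (θ * M) ^ 2 := by ring
    rw [e, hθM]
    nlinarith [sq_nonneg t]
  have c2 : exp (M ^ 2 / 4) * (√(1 - 2 * -1))⁻¹ ^ Fintype.card ι ≤ exp (-(t * M)) := by
    refine (mul_le_mul_of_nonneg_left (pow_le_pow_left₀ (by positivity) b2 _)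
      (exp_pos _).le).trans ?_
    rw [← exp_nat_mul, ← exp_add, ← hMsq]
    refine exp_le_exp.2 ?_
    nlinarith
  linarith

end Chi

/-! ### Gordon's comparison for bilinear forms on unit vectors. -/

section Sphere

variable {U V M Q : Type*} [Fintype U] [Fintype V] [Fintype M] [Fintype Q]

/-- The bilinear form `vᵀ G u`. -/
def bilin (G : M × Q → ℝ) (v : M → ℝ) (u : Q → ℝ) : ℝ := ∑ i, v i * ∑ j, G (i, j) * u j

lemma sum_mul_le_one {ι : Type*} [Fintype ι] {x y : ι → ℝ} (hx : ∑ i, x i ^ 2 = 1)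
    (hy : ∑ i, y i ^ 2 = 1) : ∑ i, x i * y i ≤ 1 := by
  have : 0 ≤ ∑ i, (x i - y i) ^ 2 := by positivity
  simp only [sub_sq, Finset.sum_add_distrib, Finset.sum_sub_distrib, hx, hy, mul_assoc,
    ← Finset.mul_sum] at this
  linarith

lemma sum_mul_le_norm {ι : Type*} [Fintype ι] {x : ι → ℝ} (hx : ∑ i, x i ^ 2 = 1)
    (y : ι → ℝ) : ∑ i, x i * y i ≤ √(∑ i, y i ^ 2) := by
  simpa [hx] using Real.sum_mul_le_sqrt_mul_sqrt Finset.univ x y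

variable [Nonempty U] [Nonempty V]

/-- Comparison of the smooth min-max of `vᵀ G u` with independent Gaussian vectors `g`, `h`. -/
lemma softF_bilin_comparison {a b : ℝ} (hb : 0 ≤ b) (hb1 : b ≤ 1) (β : ℝ) {u : U → Q → ℝ}
    {v : V → M → ℝ} (hu : ∀ s, ∑ j, u s j ^ 2 = 1) (hv : ∀ t, ∑ i, v t i ^ 2 = 1) :
    exp ((a * b * β) ^ 2 / 2) *
        ∫ G, softF a b (fun s t => β * bilin G (v t) (u s)) ∂(stdPi (M × Q)) ≤
      (∫ g, (∑ t, exp (β * ∑ i, v t i * g i)) ^ (a * b) ∂(stdPi M)) *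
        ∫ h, (∑ s, exp (a * (β * ∑ j, u s j * h j))) ^ b ∂(stdPi Q) := by
  -- The extra coordinate in `B` is the scalar `γ`; it equalizes the variances and makes the
  -- covariances agree within a row.
  let B : U → V → (M × Q) ⊕ Unit → ℝ := fun s t =>
    Sum.elim (fun ij => β * (v t ij.1 * u s ij.2)) (fun _ => β)
  let C : U → V → M ⊕ Q → ℝ := fun s t => Sum.elim (fun i => β * v t i) (fun j => β * u s j)
  have hB : ∀ s t s' t', ∑ k, B s t k * B s' t' k =
      β ^ 2 * ((∑ i, v t i * v t' i) * (∑ j, u s j * u s' j) + 1) := by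
    intro s t s' t'
    rw [Finset.sum_mul_sum]
    simp only [B, Fintype.sum_sum_type, Sum.elim_inl, Sum.elim_inr, Fintype.sum_prod_type,
      mul_add, Finset.mul_sum]
    congr 1
    · exact Finset.sum_congr rfl fun i _ => Finset.sum_congr rfl fun j _ => by ring
    · simp; ring
  have hC : ∀ s t s' t', ∑ k, C s t k * C s' t' k =
      β ^ 2 * ((∑ i, v t i * v t' i) + ∑ j, u s j * u s' j) := by
    intro s t s' t'
    simp only [C, Fintype.sum_sum_type, Sum.elim_inl, Sum.elim_inr, mul_add, Finset.mul_sum]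
    congr 1
    · exact Finset.sum_congr rfl fun i _ => by ring
    · exact Finset.sum_congr rfl fun i _ => by ring
  have key := integral_softF_le (a := a) hb hb1 B C
    (fun s t s' t' => by
      rw [hB, hC]
      have h1 := sum_mul_le_one (hv t) (hv t')
      have h2 := sum_mul_le_one (hu s) (hu s')
      refine mul_le_mul_of_nonneg_left ?_ (sq_nonneg β)
      -- The covariance difference is `(1 - ⟨v,v'⟩)(1 - ⟨u,u'⟩)`.
      nlinarith [mul_nonneg (sub_nonneg.2 h1) (sub_nonneg.2 h2)])
    (fun s t t' => by
      rw [hB, hC]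
      have : ∑ j, u s j * u s j = 1 := by simpa only [sq] using hu s
      rw [this, mul_one])
  have eB : ∀ w s t, linProc B w s t =
      β * bilin (fun ij => w (.inl ij)) (v t) (u s) + β * w (.inr ()) := by
    intro w s t
    simp only [linProc, B, bilin, Fintype.sum_sum_type, Sum.elim_inl, Sum.elim_inr,
      Fintype.sum_prod_type, Finset.mul_sum]
    congr 1
    · exact Finset.sum_congr rfl fun i _ => Finset.sum_congr rfl fun j _ => by ring
    · simp
  have eC : ∀ w s t, linProc C w s t =
      β * (∑ i, v t i * w (.inl i)) + β * ∑ j, u s j * w (.inr j) := by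
    intro w s t
    simp only [linProc, C, Fintype.sum_sum_type, Sum.elim_inl, Sum.elim_inr, Finset.mul_sum]
    congr 1
    · exact Finset.sum_congr rfl fun i _ => by ring
    · exact Finset.sum_congr rfl fun i _ => by ring
  have fB : ∀ w, softF a b (linProc B w) =
      softF a b (fun s t => β * bilin (fun ij => w (.inl ij)) (v t) (u s)) *
        exp (a * b * β * w (.inr ())) := by
    intro w
    simp only [softF, eB, exp_add, ← Finset.sum_mul]
    have h1 : ∀ s, ((∑ t, exp (β * bilin (fun ij => w (.inl ij)) (v t) (u s))) *
        exp (β * w (.inr ()))) ^ a = (∑ t, exp (β * bilin (fun ij => w (.inl ij)) (v t) (u s))) ^ a *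
        exp (a * (β * w (.inr ()))) := fun s => by
      rw [mul_rpow (Finset.sum_nonneg fun _ _ => (exp_pos _).le) (exp_pos _).le, ← exp_mul,
        mul_comm a]
    simp only [h1, ← Finset.sum_mul]
    rw [mul_rpow (Finset.sum_nonneg fun _ _ => rpow_nonneg (Finset.sum_nonneg fun _ _ =>
      (exp_pos _).le) _) (exp_pos _).le, ← exp_mul]
    ring_nf
  have fC : ∀ w, softF a b (linProc C w) =
      (∑ t, exp (β * ∑ i, v t i * w (.inl i))) ^ (a * b) *
        (∑ s, exp (a * (β * ∑ j, u s j * w (.inr j)))) ^ b := by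
    intro w
    simp only [softF, eC, exp_add, ← Finset.sum_mul]
    have h0 : 0 ≤ ∑ t, exp (β * ∑ i, v t i * w (.inl i)) :=
      Finset.sum_nonneg fun _ _ => (exp_pos _).le
    have h1 : ∀ s, ((∑ t, exp (β * ∑ i, v t i * w (.inl i))) *
        exp (β * ∑ j, u s j * w (.inr j))) ^ a = (∑ t, exp (β * ∑ i, v t i * w (.inl i))) ^ a *
        exp (a * (β * ∑ j, u s j * w (.inr j))) := fun s => by
      rw [mul_rpow h0 (exp_pos _).le, ← exp_mul, mul_comm a]
    simp only [h1, ← Finset.mul_sum]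
    rw [mul_rpow (rpow_nonneg h0 _) (Finset.sum_nonneg fun _ _ => (exp_pos _).le), ← rpow_mul h0]
  simp only [fB, fC] at key
  rw [integral_stdPi_sum_mul (f := fun G => softF a b (fun s t => β * bilin G (v t) (u s)))
    (g := fun x : Unit → ℝ => exp (a * b * β * x ())) (by unfold softF bilin; fun_prop)
    (by fun_prop),
    integral_stdPi_sum_mul (f := fun g => (∑ t, exp (β * ∑ i, v t i * g i)) ^ (a * b))
    (g := fun h => (∑ s, exp (a * (β * ∑ j, u s j * h j))) ^ b) (by fun_prop) (by fun_prop)]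
    at key
  have hγ : ∫ x : Unit → ℝ, exp (a * b * β * x ()) ∂(stdPi Unit) = exp ((a * b * β) ^ 2 / 2) := by
    have := integral_fintype_prod_eq_prod (ι := Unit) (μ := fun _ => gaussianReal 0 1)
      (f := fun _ x => exp (a * b * β * x))
    simpa [integral_exp_mul_gaussian] using this
  rwa [hγ, mul_comm] at key

end Sphere

/-! ### Finite nets dual to the Euclidean norm. -/

section Net

variable {ι : Type*} [Fintype ι]

lemma isCompact_unitSphere : IsCompact {x : ι → ℝ | ∑ i, x i ^ 2 = 1} := by
  refine (isCompact_univ_pi fun _ : ι => isCompact_Icc (a := (-1 : ℝ)) (b := 1)).of_isClosed_subset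
    (isClosed_eq (by fun_prop) continuous_const) fun x hx i _ => ?_
  have h := Finset.single_le_sum (f := fun i => x i ^ 2) (fun _ _ => sq_nonneg _)
    (Finset.mem_univ i)
  exact abs_le.1 ((sq_le_one_iff_abs_le_one _).1 (h.trans_eq hx))

lemma exists_norm_mul_unit [Nonempty ι] (g : ι → ℝ) :
    ∃ x : ι → ℝ, ∑ i, x i ^ 2 = 1 ∧ ∀ i, g i = √(∑ i, g i ^ 2) * x i := by
  classical
  rcases eq_or_ne (∑ i, g i ^ 2) 0 with h | h
  · obtain ⟨k⟩ := ‹Nonempty ι›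
    refine ⟨Pi.single k 1, ?_, fun i => ?_⟩
    · simp [Pi.single_apply]
    · have := (Finset.sum_eq_zero_iff_of_nonneg fun i _ => sq_nonneg (g i)).1 h i (Finset.mem_univ i)
      rw [h, sqrt_zero, zero_mul]
      exact pow_eq_zero_iff two_ne_zero |>.1 this
  · have h0 : 0 < ∑ i, g i ^ 2 := lt_of_le_of_ne (by positivity) h.symm
    have h1 : 0 < √(∑ i, g i ^ 2) := sqrt_pos.2 h0
    refine ⟨fun i => g i / √(∑ i, g i ^ 2), ?_, fun i => by field_simp⟩
    simp only [div_pow, sq_sqrt h0.le, ← Finset.sum_div]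
    exact div_self h

/-- A finite set of unit vectors which almost computes the Euclidean norm by duality. -/
lemma exists_finite_net [Nonempty ι] {η : ℝ} (hη : η < 1) :
    ∃ s : Finset (ι → ℝ), s.Nonempty ∧ (∀ v ∈ s, ∑ i, v i ^ 2 = 1) ∧
      ∀ g : ι → ℝ, ∃ v ∈ s, η * √(∑ i, g i ^ 2) ≤ ∑ i, v i * g i := by
  -- Cover the sphere by the open half-spaces `⟨v,x⟩ > η`; since `η < 1`, each one contains its own
  -- `v`.
  obtain ⟨s, hs, hcov⟩ := isCompact_unitSphere.elim_nhds_subcover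
    (fun v : ι → ℝ => {x | η < ∑ i, v i * x i}) fun v hv =>
      (isOpen_lt continuous_const (by fun_prop)).mem_nhds (by
        have : ∑ i, v i * v i = 1 := by simpa [sq] using hv
        change η < ∑ i, v i * v i
        rwa [this])
  have key : ∀ g : ι → ℝ, ∃ v ∈ s, η * √(∑ i, g i ^ 2) ≤ ∑ i, v i * g i := by
    intro g
    obtain ⟨x, hx, hgx⟩ := exists_norm_mul_unit g
    obtain ⟨v, hv, hvx⟩ := Set.mem_iUnion₂.1 (hcov hx)
    refine ⟨v, hv, ?_⟩
    have : ∑ i, v i * g i = √(∑ i, g i ^ 2) * ∑ i, v i * x i := by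
      rw [Finset.mul_sum]
      refine Finset.sum_congr rfl fun i _ => ?_
      conv_lhs => rw [hgx i]
      ring
    rw [this, mul_comm]
    exact mul_le_mul_of_nonneg_left (le_of_lt hvx) (sqrt_nonneg _)
  obtain ⟨v, hv, -⟩ := key 0
  exact ⟨s, ⟨v, hv⟩, hs, key⟩

end Net

/-! ### Singular value tails over finitely many directions. -/

section FiniteTail

variable {U V M Q : Type*} [Fintype U] [Fintype V] [Fintype M] [Fintype Q]

/-- The Euclidean norm of `G u`. -/
noncomputable def imageNorm (G : M × Q → ℝ) (u : Q → ℝ) : ℝ := √(∑ i, (∑ j, G (i, j) * u j) ^ 2)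

lemma continuous_imageNorm (u : Q → ℝ) : Continuous fun G : M × Q → ℝ => imageNorm G u := by
  unfold imageNorm; fun_prop

lemma continuous_imageNorm_right (G : M × Q → ℝ) : Continuous fun u : Q → ℝ => imageNorm G u := by
  unfold imageNorm; fun_prop

/-- Replacing maxima by sums of exponentials costs cardinalities raised to the power `t/β`, which
disappear as `β → ∞`. The nets may therefore have any finite size. -/
lemma tendsto_const_rpow_div {K : ℝ} (hK : 0 < K) (t : ℝ) :
    Tendsto (fun β : ℝ => K ^ (t / β)) atTop (𝓝 1) := by
  have h := (Real.continuousAt_const_rpow hK.ne' (b := 0)).tendsto.comp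
    ((tendsto_const_nhds (x := t)).div_atTop tendsto_id)
  simpa [Function.comp_def] using h

lemma measureReal_le_integral_of_one_le {α : Type*} [MeasurableSpace α] {μ : Measure α}
    [IsFiniteMeasure μ] {s : Set α} {f : α → ℝ} (hf : Integrable f μ) (h0 : ∀ x, 0 ≤ f x)
    (h1 : ∀ x ∈ s, 1 ≤ f x) : μ.real s ≤ ∫ x, f x ∂μ := by
  have h := mul_meas_ge_le_integral_of_nonneg (ae_of_all μ h0) hf 1
  rw [one_mul] at h
  exact (measureReal_mono fun x hx => h1 x hx).trans h

lemma bilin_le_imageNorm {v : M → ℝ} (hv : ∑ i, v i ^ 2 = 1) (G : M × Q → ℝ) (u : Q → ℝ) :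
    bilin G v u ≤ imageNorm G u := sum_mul_le_norm hv _

lemma integral_sum_exp_rpow_le {a b β : ℝ} (ha : |a| ≤ 1) (hb : 0 ≤ b) (hβ : 0 ≤ β)
    {u : U → Q → ℝ} (hu : ∀ s, ∑ j, u s j ^ 2 = 1) :
    ∫ h, (∑ s, exp (a * (β * ∑ j, u s j * h j))) ^ b ∂(stdPi Q) ≤
      (Fintype.card U : ℝ) ^ b * ∫ h, exp (b * β * √(∑ j, h j ^ 2)) ∂(stdPi Q) := by
  rw [← integral_const_mul]
  refine integral_mono_of_nonneg (ae_of_all _ fun h => rpow_nonneg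
    (Finset.sum_nonneg fun _ _ => (exp_pos _).le) _)
    ((integrable_exp_mul_norm _).const_mul _) (ae_of_all _ fun h => ?_)
  have h1 : ∑ s, exp (a * (β * ∑ j, u s j * h j)) ≤
      Fintype.card U * exp (β * √(∑ j, h j ^ 2)) := by
    rw [← nsmul_eq_mul, Fintype.card, ← Finset.sum_const]
    refine Finset.sum_le_sum fun s _ => exp_le_exp.2 ?_
    have h2 : |∑ j, u s j * h j| ≤ √(∑ j, h j ^ 2) := by
      refine abs_le.2 ⟨?_, sum_mul_le_norm (hu s) h⟩
      have := sum_mul_le_norm (hu s) fun j => -h j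
      simp only [mul_neg, Finset.sum_neg_distrib, even_two, Even.neg_pow] at this
      linarith
    calc a * (β * ∑ j, u s j * h j) ≤ |a * (β * ∑ j, u s j * h j)| := le_abs_self _
      _ = |a| * (β * |∑ j, u s j * h j|) := by rw [abs_mul, abs_mul, abs_of_nonneg hβ]
      _ ≤ 1 * (β * √(∑ j, h j ^ 2)) := by gcongr
      _ = _ := one_mul _
  refine (rpow_le_rpow (Finset.sum_nonneg fun _ _ => (exp_pos _).le) h1 hb).trans_eq ?_
  rw [mul_rpow (Nat.cast_nonneg _) (exp_pos _).le, ← exp_mul]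
  ring_nf

variable [Nonempty U] [Nonempty V]

lemma integrable_softF_bilin (a b β : ℝ) (u : U → Q → ℝ) (v : V → M → ℝ) :
    Integrable (fun G => softF a b (fun s t => β * bilin G (v t) (u s))) (stdPi (M × Q)) := by
  have h := integrable_softF a b (fun s t (ij : M × Q) => β * (v t ij.1 * u s ij.2))
  refine h.congr (ae_of_all _ fun G => ?_)
  simp only [softF, linProc, bilin, Fintype.sum_prod_type, Finset.mul_sum]
  congr! 7
  ring

/-- Lower tail of `min ‖G u‖` over finitely many unit vectors. -/
lemma measureReal_exists_imageNorm_lt {u : U → Q → ℝ} (hu : ∀ s, ∑ j, u s j ^ 2 = 1) {t : ℝ}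
    (ht : 0 < t) (htm : t ≤ √(Fintype.card M) / 4) (c : ℝ) :
    (stdPi (M × Q)).real {G | ∃ s, imageNorm G (u s) < c} ≤
      exp (t * c + t * √(Fintype.card Q) - t * √(Fintype.card M)) * (2 + exp (t ^ 2 / 2)) := by
  have hM : Nonempty M := by
    by_contra h
    rw [not_nonempty_iff] at h
    simp at htm
    linarith
  set A := (stdPi (M × Q)).real {G | ∃ s, imageNorm G (u s) < c}
  set Ih := ∫ h : Q → ℝ, exp (t * √(∑ j, h j ^ 2)) ∂(stdPi Q)
  have hIh0 : 0 ≤ Ih := integral_nonneg fun _ => (exp_pos _).le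
  have step : ∀ μ, 0 < μ → μ < t →
      A ≤ exp (t * c - t ^ 2 / 2) * ((∫ g : M → ℝ, exp (-μ * √(∑ i, g i ^ 2)) ∂(stdPi M)) * Ih) := by
    intro μ hμ hμt
    -- Accuracy `μ/t` turns `exp(-t max⟨v,g⟩)` into at most `exp(-μ‖g‖)`; the loss is removed at the
    -- end by letting `μ` increase to `t`.
    obtain ⟨S, hSne, hS1, hS⟩ := exists_finite_net (ι := M) (η := μ / t) ((div_lt_one ht).2 hμt)
    have : Nonempty S := hSne.to_subtype
    set Ig := ∫ g : M → ℝ, exp (-μ * √(∑ i, g i ^ 2)) ∂(stdPi M)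
    set nU : ℝ := (Fintype.card U : ℝ)
    set nV : ℝ := (Fintype.card S : ℝ)
    have hnU : 0 < nU := Nat.cast_pos.2 Fintype.card_pos
    have hnV : 0 < nV := Nat.cast_pos.2 Fintype.card_pos
    have hv : ∀ v : S, ∑ i, v.1 i ^ 2 = 1 := fun v => hS1 v.1 v.2
    have bound : ∀ β, t < β →
        A ≤ (nV * nU) ^ (t / β) * (exp (t * c - t ^ 2 / 2) * (Ig * Ih)) := by
      intro β hβ
      have hβ0 : 0 < β := ht.trans hβ
      set b := t / β with hb
      have hb0 : 0 ≤ b := by positivity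
      have hb1 : b ≤ 1 := (div_le_one hβ0).2 hβ.le
      have hbβ : b * β = t := div_mul_cancel₀ _ hβ0.ne'
      set I := ∫ G, softF (-1) b (fun s (v : S) => β * bilin G v.1 (u s)) ∂(stdPi (M × Q))
      have h1 : A ≤ nV ^ b * exp (t * c) * I := by
        rw [← integral_const_mul]
        refine measureReal_le_integral_of_one_le
          ((integrable_softF_bilin (-1) b β u fun v : S => v.1).const_mul _)
          (fun G => mul_nonneg (by positivity) (softF_pos _ _ _).le) ?_
        rintro G ⟨s, hs⟩
        have hZ : ∑ v : S, exp (β * bilin G v.1 (u s)) ≤ nV * exp (β * c) := by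
          rw [← nsmul_eq_mul, Fintype.card, ← Finset.sum_const]
          refine Finset.sum_le_sum fun v _ => exp_le_exp.2 ?_
          exact mul_le_mul_of_nonneg_left ((bilin_le_imageNorm (hv v) G (u s)).trans hs.le) hβ0.le
        have hZ0 : 0 < ∑ v : S, exp (β * bilin G v.1 (u s)) :=
          softZ_pos (fun s (v : S) => β * bilin G v.1 (u s)) s
        have hW : (∑ v : S, exp (β * bilin G v.1 (u s))) ^ (-1 : ℝ) ≤
            ∑ s, (∑ v : S, exp (β * bilin G v.1 (u s))) ^ (-1 : ℝ) :=
          Finset.single_le_sum (f := fun s => (∑ v : S, exp (β * bilin G v.1 (u s))) ^ (-1 : ℝ))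
            (fun s _ => rpow_nonneg (Finset.sum_nonneg fun _ _ => (exp_pos _).le) _)
            (Finset.mem_univ s)
        rw [rpow_neg_one] at hW
        have e : nV ^ b * exp (t * c) = (nV * exp (β * c)) ^ b := by
          rw [mul_rpow hnV.le (exp_pos _).le, ← exp_mul, ← hbβ]; ring_nf
        rw [e, softF, ← mul_rpow (by positivity) ((inv_pos.2 hZ0).le.trans hW)]
        refine one_le_rpow ?_ hb0
        calc (1 : ℝ) = (∑ v : S, exp (β * bilin G v.1 (u s))) *
              (∑ v : S, exp (β * bilin G v.1 (u s)))⁻¹ := (mul_inv_cancel₀ hZ0.ne').symm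
          _ ≤ _ := mul_le_mul hZ hW (inv_pos.2 hZ0).le (by positivity)
      have h2 := softF_bilin_comparison (a := -1) hb0 hb1 β hu hv
      have h3 : ∫ g : M → ℝ, (∑ v : S, exp (β * ∑ i, v.1 i * g i)) ^ (-1 * b) ∂(stdPi M) ≤ Ig := by
        refine integral_mono_of_nonneg (ae_of_all _ fun g => rpow_nonneg
          (Finset.sum_nonneg fun _ _ => (exp_pos _).le) _) (integrable_exp_mul_norm _)
          (ae_of_all _ fun g => ?_)
        obtain ⟨v, hvS, hvg⟩ := hS g
        have hZ : exp (β * (μ / t * √(∑ i, g i ^ 2))) ≤ ∑ v : S, exp (β * ∑ i, v.1 i * g i) :=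
          (exp_le_exp.2 (mul_le_mul_of_nonneg_left hvg hβ0.le)).trans
            (Finset.single_le_sum (f := fun v : S => exp (β * ∑ i, v.1 i * g i))
              (fun _ _ => (exp_pos _).le) (Finset.mem_univ (⟨v, hvS⟩ : S)))
        refine (rpow_le_rpow_of_nonpos (exp_pos _) hZ (by linarith)).trans_eq ?_
        rw [← exp_mul]
        congr 1
        rw [hb]
        field_simp
      have h4 := integral_sum_exp_rpow_le (a := -1) (by simp) hb0 hβ0.le hu
      rw [hbβ] at h4
      rw [show (-1 * b * β) ^ 2 = t ^ 2 by rw [mul_assoc, hbβ]; ring] at h2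
      have h5 : exp (t ^ 2 / 2) * I ≤ Ig * (nU ^ b * Ih) :=
        h2.trans (mul_le_mul h3 h4 (integral_nonneg fun _ => rpow_nonneg
          (Finset.sum_nonneg fun _ _ => (exp_pos _).le) _)
          (integral_nonneg fun _ => (exp_pos _).le))
      have h6 : I ≤ exp (-(t ^ 2 / 2)) * (Ig * (nU ^ b * Ih)) := by
        rw [exp_neg, ← div_eq_inv_mul, le_div_iff₀ (exp_pos _), mul_comm]
        exact h5
      calc A ≤ nV ^ b * exp (t * c) * I := h1
        _ ≤ nV ^ b * exp (t * c) * (exp (-(t ^ 2 / 2)) * (Ig * (nU ^ b * Ih))) := by gcongr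
        _ = _ := by
          rw [mul_rpow hnV.le hnU.le, sub_eq_add_neg, exp_add]; ring
    have hlim := (tendsto_const_rpow_div (mul_pos hnV hnU) t).mul_const
      (exp (t * c - t ^ 2 / 2) * (Ig * Ih))
    rw [one_mul] at hlim
    exact ge_of_tendsto hlim ((eventually_gt_atTop t).mono bound)
  have step2 : ∀ μ, 0 < μ → μ < t → A ≤ exp (t * c + t * √(Fintype.card Q)) *
      (exp (-(μ * √(Fintype.card M))) * (2 + exp (μ ^ 2 / 2))) := by
    intro μ hμ hμt
    have b1 := integral_exp_neg_mul_norm_le (ι := M) hμ (hμt.le.trans htm)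
    have b2 := integral_exp_mul_norm_le (ι := Q) ht
    calc A ≤ _ := step μ hμ hμt
      _ ≤ exp (t * c - t ^ 2 / 2) * ((exp (-(μ * √(Fintype.card M))) * (2 + exp (μ ^ 2 / 2))) *
          exp (t * √(Fintype.card Q) + t ^ 2 / 2)) := by gcongr
      _ = (exp (t * c - t ^ 2 / 2) * exp (t * √(Fintype.card Q) + t ^ 2 / 2)) *
          (exp (-(μ * √(Fintype.card M))) * (2 + exp (μ ^ 2 / 2))) := by ring
      _ = _ := by rw [← exp_add]; ring_nf
  have hlim : Tendsto (fun μ : ℝ => exp (t * c + t * √(Fintype.card Q)) *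
      (exp (-(μ * √(Fintype.card M))) * (2 + exp (μ ^ 2 / 2)))) (𝓝[<] t)
      (𝓝 (exp (t * c + t * √(Fintype.card Q)) *
      (exp (-(t * √(Fintype.card M))) * (2 + exp (t ^ 2 / 2))))) :=
    (Continuous.tendsto (by fun_prop) t).mono_left nhdsWithin_le_nhds
  have hev : ∀ᶠ μ in 𝓝[<] t, A ≤ exp (t * c + t * √(Fintype.card Q)) *
      (exp (-(μ * √(Fintype.card M))) * (2 + exp (μ ^ 2 / 2))) := by
    filter_upwards [Ioo_mem_nhdsLT ht] with μ hμ using step2 μ hμ.1 hμ.2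
  refine (ge_of_tendsto hlim hev).trans_eq ?_
  rw [← mul_assoc, ← exp_add]
  ring_nf

/-- Upper tail of `max ‖G u‖` over finitely many unit vectors. -/
lemma measureReal_exists_lt_imageNorm [Nonempty M] {u : U → Q → ℝ}
    (hu : ∀ s, ∑ j, u s j ^ 2 = 1) {t : ℝ} (ht : 0 < t) (c : ℝ) :
    (stdPi (M × Q)).real {G | ∃ s, c < imageNorm G (u s)} ≤
      exp (t * √(Fintype.card M) + t * √(Fintype.card Q) + t ^ 2 / 2 - t * c) := by
  set A := (stdPi (M × Q)).real {G | ∃ s, c < imageNorm G (u s)}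
  set Ig := ∫ g : M → ℝ, exp (t * √(∑ i, g i ^ 2)) ∂(stdPi M)
  set Ih := ∫ h : Q → ℝ, exp (t * √(∑ j, h j ^ 2)) ∂(stdPi Q)
  have hIg0 : 0 ≤ Ig := integral_nonneg fun _ => (exp_pos _).le
  have step : ∀ η : ℝ, 0 < η → η < 1 → A ≤ exp (-(t * (η * c)) - t ^ 2 / 2) * (Ig * Ih) := by
    intro η hη hη1
    obtain ⟨S, hSne, hS1, hS⟩ := exists_finite_net (ι := M) hη1
    have : Nonempty S := hSne.to_subtype
    set nU : ℝ := (Fintype.card U : ℝ)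
    set nV : ℝ := (Fintype.card S : ℝ)
    have hnU : 0 < nU := Nat.cast_pos.2 Fintype.card_pos
    have hnV : 0 < nV := Nat.cast_pos.2 Fintype.card_pos
    have hv : ∀ v : S, ∑ i, v.1 i ^ 2 = 1 := fun v => hS1 v.1 v.2
    have bound : ∀ β, t < β →
        A ≤ (nV * nU) ^ (t / β) * (exp (-(t * (η * c)) - t ^ 2 / 2) * (Ig * Ih)) := by
      intro β hβ
      have hβ0 : 0 < β := ht.trans hβ
      set b := t / β with hb
      have hb0 : 0 ≤ b := by positivity
      have hb1 : b ≤ 1 := (div_le_one hβ0).2 hβ.le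
      have hbβ : b * β = t := div_mul_cancel₀ _ hβ0.ne'
      set I := ∫ G, softF 1 b (fun s (v : S) => β * bilin G v.1 (u s)) ∂(stdPi (M × Q))
      have h1 : A ≤ exp (-(t * (η * c))) * I := by
        rw [← integral_const_mul]
        refine measureReal_le_integral_of_one_le
          ((integrable_softF_bilin 1 b β u fun v : S => v.1).const_mul _)
          (fun G => mul_nonneg (by positivity) (softF_pos _ _ _).le) ?_
        rintro G ⟨s, hs⟩
        -- Unlike in the lower tail, the net is used here inside the event, to find `v` with `vᵀGu ≥
        -- ηc`; afterwards `η → 1`.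
        obtain ⟨v, hvS, hvg⟩ := hS fun i => ∑ j, G (i, j) * u s j
        have hvG : η * c ≤ bilin G v (u s) := (mul_le_mul_of_nonneg_left hs.le hη.le).trans hvg
        have hW : exp (β * (η * c)) ≤ ∑ s, (∑ v : S, exp (β * bilin G v.1 (u s))) ^ (1 : ℝ) := by
          simp only [rpow_one]
          refine (exp_le_exp.2 (mul_le_mul_of_nonneg_left hvG hβ0.le)).trans
            ((Finset.single_le_sum (f := fun v : S => exp (β * bilin G v.1 (u s)))
              (fun _ _ => (exp_pos _).le) (Finset.mem_univ (⟨v, hvS⟩ : S))).trans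
            (Finset.single_le_sum (f := fun s => ∑ v : S, exp (β * bilin G v.1 (u s)))
              (fun s _ => Finset.sum_nonneg fun _ _ => (exp_pos _).le) (Finset.mem_univ s)))
        rw [exp_neg, ← div_eq_inv_mul, le_div_iff₀ (exp_pos _), one_mul, softF]
        refine le_trans (le_of_eq ?_) (rpow_le_rpow (exp_pos _).le hW hb0)
        rw [← exp_mul, ← hbβ]; ring_nf
      have h2 := softF_bilin_comparison (a := 1) hb0 hb1 β hu hv
      have h3 := integral_sum_exp_rpow_le (a := 1) (by simp) hb0 hβ0.le hv
      have h4 := integral_sum_exp_rpow_le (a := 1) (by simp) hb0 hβ0.le hu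
      rw [hbβ] at h3 h4
      simp only [one_mul] at h2 h3 h4
      rw [hbβ] at h2
      have h5 : exp (t ^ 2 / 2) * I ≤ nV ^ b * Ig * (nU ^ b * Ih) :=
        h2.trans (mul_le_mul h3 h4 (integral_nonneg fun _ => rpow_nonneg
          (Finset.sum_nonneg fun _ _ => (exp_pos _).le) _) (by positivity))
      have h6 : I ≤ exp (-(t ^ 2 / 2)) * (nV ^ b * Ig * (nU ^ b * Ih)) := by
        rw [exp_neg, ← div_eq_inv_mul, le_div_iff₀ (exp_pos _), mul_comm]
        exact h5
      calc A ≤ exp (-(t * (η * c))) * I := h1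
        _ ≤ exp (-(t * (η * c))) * (exp (-(t ^ 2 / 2)) * (nV ^ b * Ig * (nU ^ b * Ih))) := by
          gcongr
        _ = _ := by
          rw [mul_rpow hnV.le hnU.le, sub_eq_add_neg, exp_add]; ring
    have hlim := (tendsto_const_rpow_div (mul_pos hnV hnU) t).mul_const
      (exp (-(t * (η * c)) - t ^ 2 / 2) * (Ig * Ih))
    rw [one_mul] at hlim
    exact ge_of_tendsto hlim ((eventually_gt_atTop t).mono bound)
  have hlim : Tendsto (fun η : ℝ => exp (-(t * (η * c)) - t ^ 2 / 2) * (Ig * Ih)) (𝓝[<] 1)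
      (𝓝 (exp (-(t * (1 * c)) - t ^ 2 / 2) * (Ig * Ih))) :=
    (Continuous.tendsto (by fun_prop) 1).mono_left nhdsWithin_le_nhds
  have hev : ∀ᶠ η in 𝓝[<] (1 : ℝ), A ≤ exp (-(t * (η * c)) - t ^ 2 / 2) * (Ig * Ih) := by
    filter_upwards [Ioo_mem_nhdsLT one_pos] with η hη using step η hη.1 hη.2
  refine (ge_of_tendsto hlim hev).trans ?_
  have b1 := integral_exp_mul_norm_le (ι := M) ht
  have b2 := integral_exp_mul_norm_le (ι := Q) ht
  calc exp (-(t * (1 * c)) - t ^ 2 / 2) * (Ig * Ih)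
      ≤ exp (-(t * (1 * c)) - t ^ 2 / 2) * (exp (t * √(Fintype.card M) + t ^ 2 / 2) *
          exp (t * √(Fintype.card Q) + t ^ 2 / 2)) := by gcongr
    _ = _ := by rw [← exp_add, ← exp_add]; ring_nf

end FiniteTail

/-! ### From finitely many directions to the whole sphere. -/

section Tail

variable {M Q : Type*} [Fintype Q]

/-- An open condition that holds somewhere on the sphere holds at a point of a dense sequence. The
bound does not depend on the number of directions, so it passes to the increasing union. An empty
sphere (no columns) is treated separately. -/
lemma measureReal_exists_unit_le {μ : Measure (M × Q → ℝ)} [IsFiniteMeasure μ]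
    {p : (M × Q → ℝ) → (Q → ℝ) → Prop} (hp : ∀ G, IsOpen {u | p G u}) {K : ℝ} (hK : 0 ≤ K)
    (h : ∀ (N : ℕ) (u : Fin (N + 1) → Q → ℝ), (∀ s, ∑ j, u s j ^ 2 = 1) →
      μ.real {G | ∃ s, p G (u s)} ≤ K) :
    μ.real {G | ∃ u : Q → ℝ, ∑ j, u j ^ 2 = 1 ∧ p G u} ≤ K := by
  rcases isEmpty_or_nonempty {u : Q → ℝ // ∑ j, u j ^ 2 = 1} with hE | hE
  · have : {G | ∃ u : Q → ℝ, ∑ j, u j ^ 2 = 1 ∧ p G u} = ∅ := by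
      ext G
      simp only [Set.mem_ofPred_eq, Set.mem_empty_iff_false, iff_false]
      rintro ⟨u, hu, -⟩
      exact hE.false ⟨u, hu⟩
    rw [this, measureReal_empty]
    exact hK
  set d := TopologicalSpace.denseSeq {u : Q → ℝ // ∑ j, u j ^ 2 = 1}
  have hd : DenseRange d := TopologicalSpace.denseRange_denseSeq _
  have hsub : {G | ∃ u : Q → ℝ, ∑ j, u j ^ 2 = 1 ∧ p G u} ⊆
      ⋃ N : ℕ, {G | ∃ s : Fin (N + 1), p G (d s).1} := by
    rintro G ⟨u, hu, hpu⟩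
    obtain ⟨i, hi⟩ := hd.exists_mem_open ((hp G).preimage continuous_subtype_val)
      ⟨⟨u, hu⟩, hpu⟩
    exact Set.mem_iUnion.2 ⟨i, ⟨i, i.lt_succ_self⟩, hi⟩
  have hmono : Monotone fun N : ℕ => {G | ∃ s : Fin (N + 1), p G (d s).1} := by
    rintro N N' hN G ⟨s, hs⟩
    exact ⟨⟨s, by omega⟩, hs⟩
  have : μ {G | ∃ u : Q → ℝ, ∑ j, u j ^ 2 = 1 ∧ p G u} ≤ ENNReal.ofReal K := by
    refine (measure_mono hsub).trans ?_
    rw [hmono.measure_iUnion]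
    refine iSup_le fun N => ?_
    rw [← ENNReal.ofReal_toReal (measure_ne_top μ _)]
    exact ENNReal.ofReal_le_ofReal (h N (fun s => (d s).1) fun s => (d s).2)
  exact ENNReal.toReal_le_of_le_ofReal hK this

variable [Fintype M]

/-- Lower tail of the smallest singular value of a Gaussian matrix. -/
lemma measureReal_imageNorm_lt {t : ℝ} (ht : 0 < t) (ht2 : 2 ≤ exp (t ^ 2 / 2))
    (htm : t ≤ √(Fintype.card M) / 4) {c : ℝ}
    (hc : c ≤ √(Fintype.card M) - √(Fintype.card Q) - t) :
    (stdPi (M × Q)).real {G | ∃ u : Q → ℝ, ∑ j, u j ^ 2 = 1 ∧ imageNorm G u < c} ≤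
      2 * exp (-(t ^ 2 / 2)) := by
  refine measureReal_exists_unit_le (fun G => isOpen_lt (continuous_imageNorm_right G)
    continuous_const) (by positivity) fun N u hu => ?_
  refine (measureReal_exists_imageNorm_lt hu ht htm c).trans ?_
  -- The choice of `c` makes the first exponent at most `-t²`, and `2 ≤ exp(t²/2)` absorbs the
  -- additive `2`.
  calc exp (t * c + t * √(Fintype.card Q) - t * √(Fintype.card M)) * (2 + exp (t ^ 2 / 2))
      ≤ exp (-t ^ 2) * (exp (t ^ 2 / 2) + exp (t ^ 2 / 2)) := by
        gcongr
        nlinarith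
    _ = 2 * (exp (-t ^ 2) * exp (t ^ 2 / 2)) := by ring
    _ = _ := by rw [← exp_add]; ring_nf

/-- Upper tail of the operator norm of a Gaussian matrix. -/
lemma measureReal_lt_imageNorm [Nonempty M] (hQM : Fintype.card Q ≤ Fintype.card M) :
    (stdPi (M × Q)).real {G | ∃ u : Q → ℝ, ∑ j, u j ^ 2 = 1 ∧
      3 * √(Fintype.card M) < imageNorm G u} ≤ exp (-((Fintype.card M : ℝ) / 2)) := by
  refine measureReal_exists_unit_le (fun G => isOpen_lt continuous_const
    (continuous_imageNorm_right G)) (by positivity) fun N u hu => ?_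
  have hm : (0 : ℝ) < Fintype.card M := Nat.cast_pos.2 Fintype.card_pos
  -- Taking `t = √m` with `m = card M`, the exponent is at most `m + m + m/2 - 3m = -m/2`.
  refine (measureReal_exists_lt_imageNorm hu (sqrt_pos.2 hm) _).trans (exp_le_exp.2 ?_)
  have h1 : √(Fintype.card Q : ℝ) ≤ √(Fintype.card M) := sqrt_le_sqrt (by exact_mod_cast hQM)
  have h2 : √(Fintype.card M : ℝ) ^ 2 = Fintype.card M := sq_sqrt hm.le
  nlinarith [sqrt_nonneg (Fintype.card M : ℝ)]

end Tail

/-! ### The Hessian and its deterministic lower bound. -/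

section Hessian

variable {n p : ℕ}

lemma negLogLik_eq (ρ : ℝ → ℝ) (X : Matrix (Fin n) (Fin p) ℝ) (y : Fin n → ℝ)
    (L : Fin n → EuclideanSpace ℝ (Fin p) →L[ℝ] ℝ)
    (hL : ∀ i β, L i β = -(y i) * ∑ j, X i j * β j) :
    negLogLik ρ X y = fun β => ∑ i, ρ (L i β) := by
  ext β
  simp only [negLogLik, hL]

/-- The chain rule yields a factor `yᵢ²`, which is `1`, so labels survive only inside the argument
of `ρ''`. -/
lemma hessianMatrix_negLogLik {ρ : ℝ → ℝ} (hρ : Differentiable ℝ ρ)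
    (hρ' : Differentiable ℝ (deriv ρ)) (X : Matrix (Fin n) (Fin p) ℝ) {y : Fin n → ℝ}
    (hy : ∀ i, y i = 1 ∨ y i = -1) (β : EuclideanSpace ℝ (Fin p)) :
    hessianMatrix (negLogLik ρ X y) β = Matrix.of fun j k =>
      ∑ i, deriv (deriv ρ) (-(y i) * ∑ j, X i j * β j) * (X i j * X i k) := by
  let L : Fin n → EuclideanSpace ℝ (Fin p) →L[ℝ] ℝ := fun i =>
    (-(y i)) • ∑ j, X i j • (EuclideanSpace.proj j : EuclideanSpace ℝ (Fin p) →L[ℝ] ℝ)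
  have hL : ∀ i β, L i β = -(y i) * ∑ j, X i j * β j := fun i β => by
    simp [L]
  have h1 : fderiv ℝ (negLogLik ρ X y) = fun β => ∑ i, deriv ρ (L i β) • L i := by
    ext1 β
    rw [negLogLik_eq ρ X y L hL]
    refine HasFDerivAt.fderiv ?_
    exact HasFDerivAt.fun_sum fun i _ =>
      ((hρ (L i β)).hasDerivAt.comp_hasFDerivAt β (L i).hasFDerivAt)
  have h2 : HasFDerivAt (fun β => ∑ i, deriv ρ (L i β) • L i)
      (∑ i, (deriv (deriv ρ) (L i β) • L i).smulRight (L i)) β :=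
    HasFDerivAt.fun_sum fun i _ =>
      ((hρ' (L i β)).hasDerivAt.comp_hasFDerivAt β (L i).hasFDerivAt).smul_const (L i)
  have hLs : ∀ i j, L i (EuclideanSpace.single j 1) = -(y i) * X i j := fun i j => by
    rw [hL]
    simp
  ext j k
  rw [hessianMatrix, Matrix.of_apply, Matrix.of_apply, h1, h2.fderiv]
  simp only [sum_apply, ContinuousLinearMap.smulRight_apply,
    smul_apply, smul_eq_mul, hLs, hL]
  refine Finset.sum_congr rfl fun i _ => ?_
  have : y i * y i = 1 := by rcases hy i with h | h <;> rw [h] <;> norm_num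
  linear_combination deriv (deriv ρ) (-(y i) * ∑ j, X i j * β j) * (X i j * X i k) * this

lemma dotProduct_weighted_gram (w : Fin n → ℝ) (X : Matrix (Fin n) (Fin p) ℝ) (x : Fin p → ℝ) :
    x ⬝ᵥ ((Matrix.of fun j k => ∑ i, w i * (X i j * X i k)).mulVec x) =
      ∑ i, w i * (∑ j, X i j * x j) ^ 2 := by
  simp only [dotProduct, Matrix.mulVec, Matrix.of_apply, sq, Finset.mul_sum, Finset.sum_mul]
  rw [Finset.sum_congr rfl fun j _ => Finset.sum_comm, Finset.sum_comm]
  refine Finset.sum_congr rfl fun i _ => ?_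
  rw [Finset.sum_comm]
  exact Finset.sum_congr rfl fun j _ => Finset.sum_congr rfl fun k _ => by ring

/-- Deterministic lower bound on the Hessian from control of the extreme singular values. -/
lemma posSemidef_hessian {ρ : ℝ → ℝ} (hρ : Differentiable ℝ ρ) (hρ' : Differentiable ℝ (deriv ρ))
    (hρ0 : ∀ z, 0 ≤ deriv (deriv ρ) z) (X : Matrix (Fin n) (Fin p) ℝ) {y : Fin n → ℝ}
    (hy : ∀ i, y i = 1 ∨ y i = -1) (hn : 0 < n) {ε γ : ℝ} (hε : 0 < ε)
    (hup : ∀ u : Fin p → ℝ, ∑ i, (∑ j, X i j * u j) ^ 2 ≤ 9 * n * ∑ j, u j ^ 2)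
    (hlow : ∀ S : Finset (Fin n), S.card = n - ⌊ε * n⌋₊ → ∀ u : Fin p → ℝ,
      n * γ * ∑ j, u j ^ 2 ≤ ∑ i ∈ S, (∑ j, X i j * u j) ^ 2)
    (β : EuclideanSpace ℝ (Fin p)) :
    ((1 / (n : ℝ)) • hessianMatrix (negLogLik ρ X y) β -
      (sInf (deriv (deriv ρ) '' {z : ℝ | |z| ≤ 3 * ‖β‖ / √ε}) * γ) •
        (1 : Matrix (Fin p) (Fin p) ℝ)).PosSemidef := by
  classical
  have hn0 : (0 : ℝ) < n := Nat.cast_pos.2 hn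
  rw [hessianMatrix_negLogLik hρ hρ' X hy]
  set R := 3 * ‖β‖ / √ε with hR
  set I := sInf (deriv (deriv ρ) '' {z : ℝ | |z| ≤ R})
  set r : Fin n → ℝ := fun i => ∑ j, X i j * β j
  have hIle : ∀ z, |z| ≤ R → I ≤ deriv (deriv ρ) z := fun z hz =>
    csInf_le ⟨0, by rintro _ ⟨z, -, rfl⟩; exact hρ0 z⟩ ⟨z, hz, rfl⟩
  have hI0 : 0 ≤ I := sInf_nonneg (by rintro _ ⟨z, -, rfl⟩; exact hρ0 z)
  have hR2 : ε * R ^ 2 = 9 * ‖β‖ ^ 2 := by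
    rw [hR, div_pow, sq_sqrt hε.le]; field_simp; ring
  have hR0 : 0 ≤ R := by positivity
  -- few rows have a large inner product with `β`
  set bad := Finset.univ.filter fun i => R < |r i|
  have hbad : bad.card ≤ ⌊ε * n⌋₊ := by
    rcases Finset.eq_empty_or_nonempty bad with h | h
    · simp [h]
    refine Nat.le_floor ?_
    -- Strictness matters: it allows `R²` to be cancelled below without treating `R = 0` apart.
    have h1 : bad.card * R ^ 2 < ∑ i ∈ bad, r i ^ 2 := by
      rw [← nsmul_eq_mul, ← Finset.sum_const]
      refine Finset.sum_lt_sum_of_nonempty h fun i hi => ?_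
      have := (Finset.mem_filter.1 hi).2
      rw [← sq_abs (r i)]
      exact pow_lt_pow_left₀ this hR0 two_ne_zero
    have h2 : ∑ i ∈ bad, r i ^ 2 ≤ ∑ i, r i ^ 2 :=
      Finset.sum_le_sum_of_subset_of_nonneg (Finset.subset_univ _) fun _ _ _ => sq_nonneg _
    have h3 := hup β
    have h4 : ∑ j, β j ^ 2 = ‖β‖ ^ 2 := (EuclideanSpace.real_norm_sq_eq β).symm
    rw [h4] at h3
    have h5 : (bad.card : ℝ) * R ^ 2 < ε * n * R ^ 2 := by
      calc (bad.card : ℝ) * R ^ 2 < 9 * n * ‖β‖ ^ 2 := h1.trans_le (h2.trans h3)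
        _ = ε * n * R ^ 2 := by linear_combination -(n : ℝ) * hR2
    exact (lt_of_mul_lt_mul_right h5 (sq_nonneg R)).le
  -- The good rows are trimmed to a fixed cardinality, so the union bound runs over a single
  -- binomial coefficient.
  obtain ⟨S, hSsub, hS⟩ : ∃ S ⊆ badᶜ, S.card = n - ⌊ε * n⌋₊ := by
    refine Finset.exists_subset_card_eq ?_
    rw [Finset.card_compl, Fintype.card_fin]
    omega
  refine Matrix.PosSemidef.of_dotProduct_mulVec_nonneg ?_ fun x => ?_
  · ext j k
    simp only [Matrix.conjTranspose_apply, Matrix.sub_apply, Matrix.smul_apply, Matrix.of_apply,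
      star_trivial, Matrix.one_apply, eq_comm (a := k)]
    simp only [mul_comm (X _ k)]
  · rw [star_trivial, Matrix.sub_mulVec, dotProduct_sub, Matrix.smul_mulVec, Matrix.smul_mulVec,
      dotProduct_smul, dotProduct_smul, Matrix.one_mulVec, dotProduct_weighted_gram]
    have hxx : x ⬝ᵥ x = ∑ j, x j ^ 2 := by simp only [dotProduct, sq]
    rw [hxx, smul_eq_mul, smul_eq_mul, sub_nonneg, one_div, ← div_eq_inv_mul, le_div_iff₀ hn0]
    calc I * γ * (∑ j, x j ^ 2) * n = I * (n * γ * ∑ j, x j ^ 2) := by ring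
      _ ≤ I * ∑ i ∈ S, (∑ j, X i j * x j) ^ 2 := by gcongr; exact hlow S hS x
      _ ≤ ∑ i ∈ S, deriv (deriv ρ) (-(y i) * r i) * (∑ j, X i j * x j) ^ 2 := by
        rw [Finset.mul_sum]
        refine Finset.sum_le_sum fun i hi => mul_le_mul_of_nonneg_right (hIle _ ?_) (sq_nonneg _)
        have h1 : |y i| = 1 := by rcases hy i with h | h <;> simp [h]
        rw [abs_mul, abs_neg, h1, one_mul]
        have := hSsub hi
        simpa [bad] using this
      _ ≤ ∑ i, deriv (deriv ρ) (-(y i) * r i) * (∑ j, X i j * x j) ^ 2 :=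
        Finset.sum_le_sum_of_subset_of_nonneg (Finset.subset_univ _) fun i _ _ =>
          mul_nonneg (hρ0 _) (sq_nonneg _)

end Hessian

/-- Entropy bound on binomial coefficients. -/
lemma choose_le_exp_binEntropy {n k : ℕ} {ε : ℝ} (hε : 0 < ε) (hε2 : ε ≤ 1 / 2)
    (hk : (k : ℝ) ≤ ε * n) : (n.choose k : ℝ) ≤ exp (n * binEntropy ε) := by
  have h1ε : 0 < 1 - ε := by linarith
  have hkn : k ≤ n := by
    have : (k : ℝ) ≤ n := hk.trans (by nlinarith [Nat.cast_nonneg (α := ℝ) n])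
    exact_mod_cast this
  -- This is one term of the expansion of `(ε + (1 - ε))ⁿ = 1`. For `ε ≤ 1/2` its weight decreases
  -- in `k`, so `k ≤ εn` may be compared with the endpoint `εn`.
  have h1 : ε ^ k * (1 - ε) ^ (n - k) * n.choose k ≤ 1 := by
    have h := add_pow ε (1 - ε) n
    rw [show ε + (1 - ε) = 1 by ring, one_pow] at h
    refine le_of_le_of_eq ?_ h.symm
    exact Finset.single_le_sum (f := fun m => ε ^ m * (1 - ε) ^ (n - m) * (n.choose m : ℝ))
      (fun m _ => by positivity) (Finset.mem_range.2 (Nat.lt_succ_of_le hkn))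
  have h2 : exp (-(n * binEntropy ε)) ≤ ε ^ k * (1 - ε) ^ (n - k) := by
    rw [← exp_log (show 0 < ε ^ k * (1 - ε) ^ (n - k) by positivity)]
    refine exp_le_exp.2 ?_
    rw [log_mul (by positivity) (by positivity), log_pow, log_pow, Nat.cast_sub hkn, binEntropy,
      log_inv, log_inv]
    have h3 : log ε ≤ log (1 - ε) := log_le_log hε (by linarith)
    nlinarith [mul_nonneg (sub_nonneg.2 hk) (sub_nonneg.2 h3)]
  calc (n.choose k : ℝ) = exp (n * binEntropy ε) * (exp (-(n * binEntropy ε)) * n.choose k) := by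
        rw [← mul_assoc, ← exp_add]; simp
    _ ≤ exp (n * binEntropy ε) * (ε ^ k * (1 - ε) ^ (n - k) * n.choose k) := by gcongr
    _ ≤ exp (n * binEntropy ε) := mul_le_of_le_one_right (exp_pos _).le h1

/-! ### Passing from unit vectors to all vectors. -/

section Homogeneity

variable {M Q : Type*} [Fintype M] [Fintype Q]

lemma exists_unit_imageNorm_sq (G : M × Q → ℝ) (u : Q → ℝ) (h0 : ∑ j, u j ^ 2 ≠ 0) :
    ∃ x : Q → ℝ, ∑ j, x j ^ 2 = 1 ∧
      ∑ i, (∑ j, G (i, j) * u j) ^ 2 = (∑ j, u j ^ 2) * imageNorm G x ^ 2 := by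
  have hQ : Nonempty Q := by
    by_contra h
    rw [not_nonempty_iff] at h
    simp at h0
  obtain ⟨x, hx, hux⟩ := exists_norm_mul_unit u
  refine ⟨x, hx, ?_⟩
  have hr : √(∑ j, u j ^ 2) ^ 2 = ∑ j, u j ^ 2 := sq_sqrt (by positivity)
  rw [imageNorm, sq_sqrt (by positivity), ← hr]
  set r := √(∑ j, u j ^ 2)
  rw [Finset.mul_sum]
  refine Finset.sum_congr rfl fun i _ => ?_
  rw [← mul_pow, Finset.mul_sum]
  congr 1
  refine Finset.sum_congr rfl fun j _ => ?_
  rw [hux j]; ring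

lemma sum_sq_le_of_imageNorm_le {G : M × Q → ℝ} {c : ℝ}
    (h : ∀ x : Q → ℝ, ∑ j, x j ^ 2 = 1 → imageNorm G x ≤ c) (u : Q → ℝ) :
    ∑ i, (∑ j, G (i, j) * u j) ^ 2 ≤ c ^ 2 * ∑ j, u j ^ 2 := by
  rcases eq_or_ne (∑ j, u j ^ 2) 0 with h0 | h0
  · have hu : ∀ j, u j = 0 := fun j => pow_eq_zero_iff two_ne_zero |>.1
      ((Finset.sum_eq_zero_iff_of_nonneg fun i _ => sq_nonneg (u i)).1 h0 j (Finset.mem_univ j))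
    simp [hu]
  · obtain ⟨x, hx, e⟩ := exists_unit_imageNorm_sq G u h0
    rw [e, mul_comm]
    gcongr
    · exact sqrt_nonneg _
    · exact h x hx

lemma le_sum_sq_of_le_imageNorm {G : M × Q → ℝ} {c : ℝ} (hc : 0 ≤ c)
    (h : ∀ x : Q → ℝ, ∑ j, x j ^ 2 = 1 → c ≤ imageNorm G x) (u : Q → ℝ) :
    c ^ 2 * ∑ j, u j ^ 2 ≤ ∑ i, (∑ j, G (i, j) * u j) ^ 2 := by
  rcases eq_or_ne (∑ j, u j ^ 2) 0 with h0 | h0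
  · rw [h0, mul_zero]
    positivity
  · obtain ⟨x, hx, e⟩ := exists_unit_imageNorm_sq G u h0
    rw [e, mul_comm]
    gcongr
    exact h x hx

end Homogeneity

/-! ### Exceptional events and the union bound. -/

section Probability

variable {Ω : Type*} [MeasurableSpace Ω] {P : Measure Ω} {n p : ℕ}
  {X : Ω → Matrix (Fin n) (Fin p) ℝ}

/-- A nonpositive probability bound is met by the empty event. -/
lemma likelihoodCurvature_of_nonpos {ρ : ℝ → ℝ} {y : Ω → Fin n → ℝ} {ε : ℝ}
    (h : 1 - 2 * exp (-(n * binEntropy ε)) - 2 * exp (-((n : ℝ) / 2)) ≤ 0) :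
    LikelihoodCurvature P ρ X y ε :=
  ⟨∅, MeasurableSet.empty, by simpa using h, fun _ h => h.elim⟩

variable [IsProbabilityMeasure P]

/-- Any family of distinct entries is again standard Gaussian, so tails for `stdPi` apply to every
row submatrix. -/
lemma _root_.IsStdGaussianDesign.measureReal_preimage (hX : IsStdGaussianDesign P X) {κ : Type*}
    [Fintype κ] {f : κ → Fin n × Fin p} (hf : f.Injective) {s : Set (κ → ℝ)}
    (hs : MeasurableSet s) :
    P.real {ω | (fun k => X ω (f k).1 (f k).2) ∈ s} = (stdPi κ).real s := by
  have hm : ∀ k, AEMeasurable (fun ω => X ω (f k).1 (f k).2) P := fun k =>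
    (hX.law (f k).1 (f k).2).aemeasurable
  have h := (iIndepFun_iff_map_fun_eq_pi_map hm).1 (hX.indep.precomp hf)
  simp only [(hX.law _ _).map_eq] at h
  rw [measureReal_def, measureReal_def, stdPi, ← h,
    Measure.map_apply_of_aemeasurable (aemeasurable_pi_lambda _ hm) hs]
  rfl

lemma isOpen_exists_unit_imageNorm_lt {M Q : Type*} [Fintype M] [Fintype Q] (c : ℝ) :
    IsOpen {G : M × Q → ℝ | ∃ u : Q → ℝ, ∑ j, u j ^ 2 = 1 ∧ imageNorm G u < c} := by
  have : {G : M × Q → ℝ | ∃ u : Q → ℝ, ∑ j, u j ^ 2 = 1 ∧ imageNorm G u < c} =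
      ⋃ u : {u : Q → ℝ // ∑ j, u j ^ 2 = 1}, {G | imageNorm G u.1 < c} := by
    ext G; simp
  rw [this]
  exact isOpen_iUnion fun u => isOpen_lt (continuous_imageNorm u.1) continuous_const

lemma isOpen_exists_unit_lt_imageNorm {M Q : Type*} [Fintype M] [Fintype Q] (c : ℝ) :
    IsOpen {G : M × Q → ℝ | ∃ u : Q → ℝ, ∑ j, u j ^ 2 = 1 ∧ c < imageNorm G u} := by
  have : {G : M × Q → ℝ | ∃ u : Q → ℝ, ∑ j, u j ^ 2 = 1 ∧ c < imageNorm G u} =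
      ⋃ u : {u : Q → ℝ // ∑ j, u j ^ 2 = 1}, {G | c < imageNorm G u.1} := by
    ext G; simp
  rw [this]
  exact isOpen_iUnion fun u => isOpen_lt continuous_const (continuous_imageNorm u.1)

theorem likelihoodCurvature {ρ : ℝ → ℝ} {y : Ω → Fin n → ℝ} (hρ : Differentiable ℝ ρ)
    (hρ' : Differentiable ℝ (deriv ρ)) (hρ0 : ∀ z, 0 ≤ deriv (deriv ρ) z)
    (hX : IsStdGaussianDesign P X) (hy : ∀ ω i, y ω i = 1 ∨ y ω i = -1) (hn : 0 < n)
    (hpn : (p : ℝ) / n < 1) {ε : ℝ} (hε0 : 0 ≤ ε) (hε : ε ≤ 1 / 2)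
    (hH : binEntropy ε ≤ 1 / 256) (hg : 0 ≤ curvatureGap n p ε) :
    LikelihoodCurvature P ρ X y ε := by
  have hn0 : (0 : ℝ) < n := Nat.cast_pos.2 hn
  have e0 := exp_pos (-((n : ℝ) / 2))
  -- the claimed probability is positive only if `n H(ε) > log 2`
  rcases le_or_gt (n * binEntropy ε) (log 2) with hsmall | hlarge
  · refine likelihoodCurvature_of_nonpos ?_
    have : exp (-log 2) ≤ exp (-(n * binEntropy ε)) := exp_le_exp.2 (by linarith)
    rw [exp_neg, exp_log two_pos] at this
    linarith
  have hε_pos : 0 < ε := by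
    rcases hε0.eq_or_lt with h | h
    · rw [← h, binEntropy_zero, mul_zero] at hlarge
      exact absurd hlarge (not_lt.2 (log_nonneg one_le_two))
    · exact h
  set H := binEntropy ε
  have hH0 : 0 ≤ H := binEntropy_nonneg hε0 (by linarith)
  have h1ε : 0 < 1 - ε := by linarith
  have : Nonempty (Fin n) := ⟨⟨0, hn⟩⟩
  have hpn' : p ≤ n := by
    rw [div_lt_one hn0] at hpn
    exact_mod_cast hpn.le
  set k := ⌊ε * n⌋₊
  have hk : (k : ℝ) ≤ ε * n := Nat.floor_le (by positivity)
  have hkn : k ≤ n := by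
    have : (k : ℝ) ≤ n := hk.trans (by nlinarith)
    exact_mod_cast this
  set γ := curvatureGap n p ε with hγ
  -- This is `√n` times the last term of `curvatureGap`, so that `√n γ = √((1-ε)n) - √p - t`.
  set t := 2 * √(n * H / (1 - ε)) with ht
  have ht2 : t ^ 2 = 4 * (n * H / (1 - ε)) := by
    rw [ht, mul_pow, sq_sqrt (by positivity)]; norm_num
  have hlog2 : 0 < log 2 := log_pos one_lt_two
  have hnH : n * H ≤ n * H / (1 - ε) := le_div_self (by positivity) h1ε (by linarith)
  have ht0 : 0 < t := by
    have : 0 < n * H / (1 - ε) := by linarith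
    positivity
  have hexp : 2 ≤ exp (t ^ 2 / 2) := by
    rw [← log_le_iff_le_exp two_pos]
    linarith
  -- the exceptional events
  let bad : Finset (Fin n) → Set Ω := fun S => {ω | (fun ij : S × Fin p => X ω ij.1 ij.2) ∈
    {G : S × Fin p → ℝ | ∃ u : Fin p → ℝ, ∑ j, u j ^ 2 = 1 ∧ imageNorm G u < √n * γ}}
  let big : Set Ω := {ω | (fun ij : Fin n × Fin p => X ω ij.1 ij.2) ∈
    {G : Fin n × Fin p → ℝ | ∃ u : Fin p → ℝ, ∑ j, u j ^ 2 = 1 ∧ 3 * √n < imageNorm G u}}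
  have hbig : P.real big ≤ exp (-((n : ℝ) / 2)) := by
    have h1 := hX.measureReal_preimage (f := id) Function.injective_id
      (isOpen_exists_unit_lt_imageNorm (M := Fin n) (Q := Fin p) (3 * √n)).measurableSet
    have h2 := measureReal_lt_imageNorm (M := Fin n) (Q := Fin p) (by simpa using hpn')
    rw [Fintype.card_fin] at h2
    exact h1.trans_le h2
  have hbad : ∀ S : Finset (Fin n), S.card = n - k → P.real (bad S) ≤ 2 * exp (-(t ^ 2 / 2)) := by
    intro S hS
    have h1 := hX.measureReal_preimage (f := fun ij : S × Fin p => (ij.1.1, ij.2))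
      (fun a b hab => by
        simp only [Prod.mk.injEq] at hab
        exact Prod.ext (Subtype.ext hab.1) hab.2)
      (isOpen_exists_unit_imageNorm_lt (M := S) (Q := Fin p) (√n * γ)).measurableSet
    have hm : (1 - ε) * n ≤ (Fintype.card S : ℝ) := by
      rw [Fintype.card_coe, hS, Nat.cast_sub hkn]
      linarith
    have hsm : √((1 - ε) * n) ≤ √(Fintype.card S : ℝ) := sqrt_le_sqrt hm
    -- It suffices that `64 H ≤ (1-ε)²`; since `ε ≤ 1/2`, this is where the threshold `1/256` comes
    -- from.
    have htm : t ≤ √(Fintype.card S : ℝ) / 4 := by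
      refine le_trans ?_ (div_le_div_of_nonneg_right hsm (by norm_num))
      refine le_of_sq_le_sq ?_ (by positivity)
      rw [ht2, div_pow, sq_sqrt (by positivity), mul_div_assoc', div_le_div_iff₀ h1ε (by norm_num)]
      have h4 : (1 / 2 : ℝ) ^ 2 ≤ (1 - ε) ^ 2 := by gcongr; linarith
      nlinarith
    have hc : √n * γ ≤ √(Fintype.card S : ℝ) - √(Fintype.card (Fin p) : ℝ) - t := by
      have e1 : √n * √(1 - ε) = √((1 - ε) * n) := by rw [mul_comm, ← sqrt_mul h1ε.le]
      have e2 : √n * √((p : ℝ) / n) = √p := by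
        rw [← sqrt_mul hn0.le, mul_div_cancel₀ _ hn0.ne']
      have e3 : √n * √(H / (1 - ε)) = √(n * H / (1 - ε)) := by
        rw [← sqrt_mul hn0.le, mul_div_assoc]
      have : √n * γ = √((1 - ε) * n) - √p - t := by
        rw [hγ, curvatureGap, ht, ← e1, ← e2, ← e3]; ring
      rw [this, Fintype.card_fin]
      linarith
    exact h1.trans_le (measureReal_imageNorm_lt ht0 hexp htm hc)
  set 𝒮 := Finset.powersetCard (n - k) (Finset.univ : Finset (Fin n))
  set B := big ∪ ⋃ S ∈ 𝒮, bad S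
  have hB : P.real B ≤ exp (-((n : ℝ) / 2)) + 2 * exp (-(n * H)) := by
    have hcard : (𝒮.card : ℝ) ≤ exp (n * H) := by
      rw [Finset.card_powersetCard, Finset.card_univ, Fintype.card_fin, Nat.choose_symm hkn]
      exact choose_le_exp_binEntropy hε_pos hε hk
    refine (measureReal_union_le _ _).trans (add_le_add hbig ?_)
    calc P.real (⋃ S ∈ 𝒮, bad S) ≤ ∑ S ∈ 𝒮, P.real (bad S) := measureReal_biUnion_finset_le _ _
      _ ≤ ∑ S ∈ 𝒮, 2 * exp (-(t ^ 2 / 2)) :=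
        Finset.sum_le_sum fun S hS => hbad S (Finset.mem_powersetCard.1 hS).2
      _ = 𝒮.card * (2 * exp (-(t ^ 2 / 2))) := by rw [Finset.sum_const, nsmul_eq_mul]
      -- Here `t²/2 = 2nH/(1-ε) ≥ 2nH`: half of this exponent pays for the number of submatrices.
      _ ≤ exp (n * H) * (2 * exp (-(2 * (n * H)))) := by
        gcongr
        linarith
      _ = 2 * (exp (n * H) * exp (-(2 * (n * H)))) := by ring
      _ = 2 * exp (-(n * H)) := by rw [← exp_add]; ring_nf
  -- The entries of `X` are only a.e. measurable, so `B` is replaced by a measurable superset of the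
  -- same measure.
  refine ⟨(toMeasurable P B)ᶜ, (measurableSet_toMeasurable P B).compl, ?_, fun ω hω β => ?_⟩
  · rw [probReal_compl_eq_one_sub (measurableSet_toMeasurable P B), measureReal_def,
      measure_toMeasurable, ← measureReal_def]
    linarith
  · have hωB : ω ∉ B := fun h => hω (subset_toMeasurable P B h)
    simp only [B, Set.mem_union, not_or, Set.mem_iUnion, not_exists] at hωB
    refine posSemidef_hessian hρ hρ' hρ0 (X ω) (hy ω) hn hε_pos (fun u => ?_) (fun S hS u => ?_) β
    · have h := sum_sq_le_of_imageNorm_le (G := fun ij : Fin n × Fin p => X ω ij.1 ij.2)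
        (c := 3 * √n) (fun x hx => not_lt.1 fun hlt => hωB.1 ⟨x, hx, hlt⟩) u
      rwa [mul_pow, sq_sqrt hn0.le, show (3 : ℝ) ^ 2 = 9 by norm_num] at h
    · have h := le_sum_sq_of_le_imageNorm (G := fun ij : S × Fin p => X ω ij.1 ij.2)
        (c := √n * γ) (by positivity)
        (fun x hx => not_lt.1 fun hlt => hωB.2 S
          (Finset.mem_powersetCard.2 ⟨Finset.subset_univ S, hS⟩) ⟨x, hx, hlt⟩) u
      rw [mul_pow, sq_sqrt hn0.le] at h
      refine h.trans_eq ?_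
      exact Finset.sum_coe_sort S fun i => (∑ j, X ω i j * u j) ^ 2

end Probability

/-! ### Choice of the threshold `ε₀`. -/

lemma eventually_nhds_zero_exists {q : ℝ → Prop} (h : ∀ᶠ ε in 𝓝 (0 : ℝ), q ε) :
    ∃ ε₀ : ℝ, 0 < ε₀ ∧ ∀ ε, 0 ≤ ε → ε ≤ ε₀ → q ε := by
  obtain ⟨δ, hδ, h⟩ := Metric.eventually_nhds_iff.1 h
  refine ⟨δ / 2, by positivity, fun ε h0 h1 => h ?_⟩
  rw [dist_zero_right, norm_of_nonneg h0]
  linarith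

lemma eventually_small : ∀ᶠ ε in 𝓝 (0 : ℝ), ε ≤ 1 / 2 ∧ binEntropy ε ≤ 1 / 256 := by
  have h : Tendsto binEntropy (𝓝 0) (𝓝 0) := by
    simpa using binEntropy_continuous.tendsto 0
  exact (eventually_le_nhds (by norm_num)).and (h.eventually (eventually_le_nhds (by norm_num)))

/-- The gap decreases in `p/n`, so replacing `p/n` by `κ` gives a bound uniform in `n` and `p`; that
bound is continuous at `ε = 0`, with value `1 - √κ > 0`. -/
lemma eventually_curvatureGap_nonneg {κ : ℝ} (hκ : κ < 1) :
    ∀ᶠ ε in 𝓝 (0 : ℝ), ∀ n p : ℕ, (p : ℝ) / n ≤ κ → 0 ≤ curvatureGap n p ε := by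
  have hc : ContinuousAt (fun ε => √(1 - ε) - √κ - 2 * √(binEntropy ε / (1 - ε))) 0 := by
    have h2 : ContinuousAt (fun ε : ℝ => binEntropy ε / (1 - ε)) 0 :=
      binEntropy_continuous.continuousAt.div (by fun_prop) (by norm_num)
    have h3 : ContinuousAt (fun ε : ℝ => √(binEntropy ε / (1 - ε))) 0 := h2.sqrt
    have h4 : ContinuousAt (fun ε : ℝ => √(1 - ε)) 0 := by fun_prop
    exact (h4.sub continuousAt_const).sub (h3.const_mul 2)
  have hκ' : √κ < 1 := by rwa [sqrt_lt' one_pos, one_pow]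
  have hpos : 0 < √(1 - 0) - √κ - 2 * √(binEntropy 0 / (1 - 0)) := by simpa using hκ'
  filter_upwards [hc.eventually (lt_mem_nhds hpos)] with ε hε n p hpn
  have := sqrt_le_sqrt hpn
  rw [curvatureGap]
  linarith

end GaussianDesign

theorem mainTheorem6 :
    (∃ ε₀ : ℝ, 0 < ε₀ ∧
      ∀ (Ω : Type*) [MeasurableSpace Ω] (P : Measure Ω) [IsProbabilityMeasure P] (ρ : ℝ → ℝ)
        (n p : ℕ) (X : Ω → Matrix (Fin n) (Fin p) ℝ) (y : Ω → Fin n → ℝ),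
        Differentiable ℝ ρ → Differentiable ℝ (deriv ρ) → (∀ z, 0 ≤ deriv (deriv ρ) z) →
        IsStdGaussianDesign P X → (∀ ω i, y ω i = 1 ∨ y ω i = -1) →
        0 < n → (p : ℝ) / n < 1 →
        ∀ ε : ℝ, 0 ≤ ε → ε ≤ ε₀ → 0 ≤ curvatureGap n p ε →
          LikelihoodCurvature P ρ X y ε) ∧
    (∀ κ : ℝ, κ < 1 → ∃ ε₀ : ℝ, 0 < ε₀ ∧
      ∀ (Ω : Type*) [MeasurableSpace Ω] (P : Measure Ω) [IsProbabilityMeasure P] (ρ : ℝ → ℝ)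
        (n p : ℕ) (X : Ω → Matrix (Fin n) (Fin p) ℝ) (y : Ω → Fin n → ℝ),
        Differentiable ℝ ρ → Differentiable ℝ (deriv ρ) → (∀ z, 0 ≤ deriv (deriv ρ) z) →
        IsStdGaussianDesign P X → (∀ ω i, y ω i = 1 ∨ y ω i = -1) →
        0 < n → (p : ℝ) / n ≤ κ →
        ∀ ε : ℝ, 0 ≤ ε → ε ≤ ε₀ → LikelihoodCurvature P ρ X y ε) := by
  refine ⟨?_, fun κ hκ => ?_⟩
  · obtain ⟨ε₀, h0, h⟩ := GaussianDesign.eventually_nhds_zero_exists GaussianDesign.eventually_small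
    refine ⟨ε₀, h0, ?_⟩
    intro Ω _ P _ ρ n p X y hρ hρ' hρ0 hX hy hn hpn ε hε0 hε hg
    obtain ⟨h1, h2⟩ := h ε hε0 hε
    exact GaussianDesign.likelihoodCurvature hρ hρ' hρ0 hX hy hn hpn hε0 h1 h2 hg
  · obtain ⟨ε₀, h0, h⟩ := GaussianDesign.eventually_nhds_zero_exists
      (GaussianDesign.eventually_small.and (GaussianDesign.eventually_curvatureGap_nonneg hκ))
    refine ⟨ε₀, h0, ?_⟩
    intro Ω _ P _ ρ n p X y hρ hρ' hρ0 hX hy hn hpn ε hε0 hε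
    obtain ⟨⟨h1, h2⟩, h3⟩ := h ε hε0 hε
    exact GaussianDesign.likelihoodCurvature hρ hρ' hρ0 hX hy hn (hpn.trans_lt hκ) hε0 h1 h2
      (h3 n p hpn)
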